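/- Fix $h\in\mathbb C$. For a totally ordered set $I$ let $H_I$ be the complex unital algebra generated by $x_i,y_i$ $(i\in I)$ with the relations $x_iy_i=y_ix_i+hy_i^2$ for $i\in I$ and, for $i<j$, $$x_jy_i=y_ix_j+hy_iy_j,\quad y_jx_i=x_iy_j-hy_iy_j,\quad y_jy_i=y_iy_j,\quad x_jx_i=x_ix_j-hx_iy_j+hy_ix_j+h^2y_iy_j .$$ Let $Q_I\supset H_I$ be its quotient division ring. Let $E,F,H$ be the linear operators on $H_I$ (the action of $U_h(sl(2))$) with $Ex_i=0$, $Ey_i=x_i$, $Fx_i=y_i$, $Fy_i=0$, $Hx_i=x_i$, $Hy_i=-y_i$, $F(ab)=F(a)b+aF(b)$ and $G(ab)=G(a)\,e^{-hF}(b)+e^{hF}(a)\,G(b)$ for $G=E,H$. An element $v$ is called invariant if $E(v)=F(v)=H(v)=0$; for example $(ij):=x_iy_j-y_ix_j-hy_iy_j$ is invariant. For $S\subset I$ let $H_{I\setminus S}$ be the subalgebra generated by the $x_i,y_i$ with $i\notin S$. An $m$-form in $x_i,y_i$ is a nonzero invariant element of the form $\sum_{k=0}^m\binom mk x_i^{m-k}y_i^kB_k$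 with $B_k\in H_{I\setminus\{i\}}$. For $i\ne j$ let $\Delta_{ij}$ be the derivation of $H_I$ with $x_i\mapsto x_j$, $y_i\mapsto y_j$ and $x_k,y_k\mapsto 0$ for $k\neq i$, and let $P_{ij}$ be the linear operator which is $\frac1d\Delta_{ij}$ on elements of degree $d\ge 1$ with respect to the index $i$, and $0$ on elements of degree $0$. Theorem 13 (typical representation). Let $n\ge 1$. There are noncommutative polynomials $C_0,\dots,C_n$ in $n+3$ variables with complex coefficients, and integers $m_0,\dots,m_n\ge 0$, depending only on $n$ and $h$, such that the following holds for every totally ordered set $I$ with two distinct elements $0,1\in I$. Let $$f=x_0^nA_0+x_0^{n-1}y_0A_1+\dots+y_0^nA_n,\qquad A_k\in H_{I\setminus\{0,1\}},$$ be an $n$-form in $x_0,y_0$, and put $f_1:=P_{01}^nf$, $\xi:=P_{01}^{n-1}f$, $\eta:=(01)$ and $u_k:=C_k(A_0,\dots,A_n,x_1,y_1)$. Then $f_1\in H_{I\setminus\{0\}}$ and $f_1\neq0$; $\xi=P_{10}f_1$; $\xi$ and $\eta$ are $1$-forms in $x_0,y_0$ and central in $H_I$; $u_k\in H_{I\setminus\{0\}}$,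 and $u_k$ is a covariant of $f$ with respect to $x_1,y_1$, i.e. $u_k$ is zero or an $m_k$-form in $x_1,y_1$; and in $Q_I$ $$f=f_1^{-n}\left(\xi^nu_0+\xi^{n-1}\eta\,u_1+\dots+\eta^nu_n\right).$$ -/

import Mathlib

universe u

namespace NCForm

/-! ### The algebra `H_I` and the action of `U_h(sl(2))` -/

/-- The variables `x_i`, `y_i`, `i ∈ I`. -/
inductive Gen (I : Type*) : Type _
  | x (i : I) : Gen I
  | y (i : I) : Gen I

section Alg
variable {I : Type*}

/-- `x_i` in the free algebra. -/
def fx (i : I) : FreeAlgebra ℂ (Gen I) := FreeAlgebra.ι ℂ (Gen.x i)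
/-- `y_i` in the free algebra. -/
def fy (i : I) : FreeAlgebra ℂ (Gen I) := FreeAlgebra.ι ℂ (Gen.y i)

/-- The quadratic relations between the variables. -/
inductive Rel (h : ℂ) (I : Type*) [LinearOrder I] :
    FreeAlgebra ℂ (Gen I) → FreeAlgebra ℂ (Gen I) → Prop
  | xy_self (i : I) : Rel h I (fx i * fy i) (fy i * fx i + h • (fy i * fy i))
  | xy {i j : I} (hij : i < j) : Rel h I (fx j * fy i) (fy i * fx j + h • (fy i * fy j))
  | yx {i j : I} (hij : i < j) : Rel h I (fy j * fx i) (fx i * fy j - h • (fy i * fy j))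
  | yy {i j : I} (hij : i < j) : Rel h I (fy j * fy i) (fy i * fy j)
  | xx {i j : I} (hij : i < j) : Rel h I (fx j * fx i)
      (fx i * fx j - h • (fx i * fy j) + h • (fy i * fx j) + h ^ 2 • (fy i * fy j))

end Alg

/-- The algebra `H_I`: free complex algebra on the `x_i`, `y_i` modulo the relations `Rel`. -/
def HAlg (h : ℂ) (I : Type*) [LinearOrder I] : Type _ := RingQuot (Rel h I)

noncomputable instance (h : ℂ) (I : Type*) [LinearOrder I] : Ring (HAlg h I) :=
  inferInstanceAs (Ring (RingQuot (Rel h I)))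

noncomputable instance (h : ℂ) (I : Type*) [LinearOrder I] : Algebra ℂ (HAlg h I) :=
  inferInstanceAs (Algebra ℂ (RingQuot (Rel h I)))

/-- The quotient map from the free algebra. -/
noncomputable def mk (h : ℂ) (I : Type*) [LinearOrder I] :
    FreeAlgebra ℂ (Gen I) →ₐ[ℂ] HAlg h I := RingQuot.mkAlgHom ℂ (Rel h I)

theorem mk_rel {h : ℂ} {I : Type*} [LinearOrder I] {a b : FreeAlgebra ℂ (Gen I)}
    (r : Rel h I a b) : mk h I a = mk h I b := RingQuot.mkAlgHom_rel ℂ r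

variable (h : ℂ) {I : Type*} [LinearOrder I]

/-- The generator `x_i` of `H_I`. -/
noncomputable def X (i : I) : HAlg h I := mk h I (fx i)
/-- The generator `y_i` of `H_I`. -/
noncomputable def Y (i : I) : HAlg h I := mk h I (fy i)

/-- The defining relations of `H_I`, for families `a`, `b` in an arbitrary algebra. In `H_I` they
hold regardless of the order of the indices, see `good_XY`. -/
structure Good (h : ℂ) {I B : Type*} [Ring B] [Algebra ℂ B] (a b : I → B) : Prop where
  yy (i j : I) : b j * b i = b i * b j
  xy (i j : I) : a j * b i = b i * a j + h • (b i * b j)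
  xx (i j : I) : a j * a i =
    a i * a j - h • (a i * b j) + h • (b i * a j) + h ^ 2 • (b i * b j)

theorem good_XY : Good h (X h : I → HAlg h I) (Y h) := by
  have yy' : ∀ i j : I, i < j → Y h j * Y h i = Y h i * Y h j := fun i j hij => by
    simpa [X, Y] using mk_rel (Rel.yy (h := h) hij)
  have yy : ∀ i j : I, Y h j * Y h i = Y h i * Y h j := fun i j => by
    rcases lt_trichotomy i j with hij | rfl | hij
    · exact yy' i j hij
    · rfl
    · exact (yy' j i hij).symm
  have xy : ∀ i j : I, X h j * Y h i = Y h i * X h j + h • (Y h i * Y h j) := fun i j => by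
    rcases lt_trichotomy i j with hij | rfl | hij
    · simpa [X, Y] using mk_rel (Rel.xy (h := h) hij)
    · simpa [X, Y] using mk_rel (Rel.xy_self (h := h) i)
    · have := mk_rel (Rel.yx (h := h) hij)
      simp only [map_mul, map_sub, map_smul] at this
      change Y h i * X h j = X h j * Y h i - h • (Y h j * Y h i) at this
      rw [this, yy]; abel
  have xx' : ∀ i j : I, i < j → X h j * X h i = X h i * X h j - h • (X h i * Y h j)
      + h • (Y h i * X h j) + h ^ 2 • (Y h i * Y h j) := fun i j hij => by
    simpa [X, Y] using mk_rel (Rel.xx (h := h) hij)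
  refine ⟨yy, xy, fun i j => ?_⟩
  rcases lt_trichotomy i j with hij | rfl | hij
  · exact xx' i j hij
  · rw [xy]; module
  · rw [xx' j i hij, xy i j, xy j i, yy i j]; module

variable {h}

/-- Algebra homomorphisms out of `H_I` are given by families satisfying the relations. -/
noncomputable def lift {B : Type*} [Ring B] [Algebra ℂ B] (a b : I → B) (H : Good h a b) :
    HAlg h I →ₐ[ℂ] B :=
  RingQuot.liftAlgHom ℂ ⟨FreeAlgebra.lift ℂ (fun g => match g with
    | Gen.x i => a i
    | Gen.y i => b i), by
      intro u v huv
      cases huv with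
      | xy_self i => simpa [fx, fy] using H.xy i i
      | xy _ => simpa [fx, fy] using H.xy _ _
      | @yx i j _ => simp [fx, fy, H.xy j i, H.yy i j]
      | yy _ => simpa [fx, fy] using H.yy _ _
      | xx _ => simpa [fx, fy] using H.xx _ _⟩

section
variable {B : Type*} [Ring B] [Algebra ℂ B] (a b : I → B) (H : Good h a b)

@[simp] theorem lift_X (i : I) : lift a b H (X h i) = a i := by
  exact (RingQuot.liftAlgHom_mkAlgHom_apply (S := ℂ) _ _ _).trans (by simp [fx])

@[simp] theorem lift_Y (i : I) : lift a b H (Y h i) = b i := by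
  exact (RingQuot.liftAlgHom_mkAlgHom_apply (S := ℂ) _ _ _).trans (by simp [fy])
end

theorem hom_ext {B : Type*} [Ring B] [Algebra ℂ B] {p q : HAlg h I →ₐ[ℂ] B}
    (hx : ∀ i, p (X h i) = q (X h i)) (hy : ∀ i, p (Y h i) = q (Y h i)) : p = q := by
  apply RingQuot.ringQuot_ext'
  apply FreeAlgebra.hom_ext
  funext g
  cases g with
  | x i => exact hx i
  | y i => exact hy i

variable (h) in
/-- The action of `e^{tF}` on `H_I`. Since `F` is a derivation with `F x_i = y_i`, `F y_i = 0`, this is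
the algebra automorphism `x_i ↦ x_i + t y_i`, `y_i ↦ y_i`; see `expF_eq_sum` for the equality with
the (locally finite) exponential series. -/
noncomputable def expF (t : ℂ) : HAlg h I →ₐ[ℂ] HAlg h I :=
  lift (fun i => X h i + t • Y h i) (fun i => Y h i) (by
    have G := good_XY h (I := I)
    refine ⟨G.yy, fun i j => ?_, fun i j => ?_⟩
    · simp only [add_mul, mul_add, smul_mul_assoc, mul_smul_comm, G.xy i j, G.yy i j]; module
    · simp only [add_mul, mul_add, smul_mul_assoc, mul_smul_comm, smul_add, G.xx i j, G.xy i j,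
        G.xy j i, G.yy i j]; module)

/-- The condition that there is a linear operator `D` on `H_I` with `D (x_i) = p i`, `D (y_i) = q i` and
`D (a b) = D (a) t (b) + s (a) D (b)`, expressed through the upper triangular matrices
`!![s a, D a; 0, t a]`. -/
structure GoodT (h : ℂ) {I : Type*} [LinearOrder I] (s t : HAlg h I →ₐ[ℂ] HAlg h I)
    (p q : I → HAlg h I) : Prop where
  good : Good h (fun i => !![s (X h i), p i; 0, t (X h i)])
    (fun i => !![s (Y h i), q i; 0, t (Y h i)])

/-- The homomorphism `a ↦ !![s a, D a; 0, t a]`. -/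
noncomputable def twist (s t : HAlg h I →ₐ[ℂ] HAlg h I) (p q : I → HAlg h I) (G : GoodT h s t p q) :
    HAlg h I →ₐ[ℂ] Matrix (Fin 2) (Fin 2) (HAlg h I) := lift _ _ G.good

/-- The operator `D` with `D (x_i) = p i`, `D (y_i) = q i` and
`D (a b) = D (a) t (b) + s (a) D (b)`, see `twistDer_mul`. -/
noncomputable def twistDer (s t : HAlg h I →ₐ[ℂ] HAlg h I) (p q : I → HAlg h I) (G : GoodT h s t p q) :
    HAlg h I →ₗ[ℂ] HAlg h I where
  toFun a := twist s t p q G a 0 1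
  map_add' a b := by simp
  map_smul' c a := by simp

section
variable (s t : HAlg h I →ₐ[ℂ] HAlg h I) (p q : I → HAlg h I) (G : GoodT h s t p q)

@[simp] theorem twistDer_X (i : I) : twistDer s t p q G (X h i) = p i := by
  simp [twistDer, twist]

@[simp] theorem twistDer_Y (i : I) : twistDer s t p q G (Y h i) = q i := by
  simp [twistDer, twist]

@[elab_as_elim]
theorem induct {C : HAlg h I → Prop} (a : HAlg h I) (hc : ∀ c : ℂ, C (algebraMap ℂ _ c))
    (hx : ∀ i, C (X h i)) (hy : ∀ i, C (Y h i)) (hadd : ∀ a b, C a → C b → C (a + b))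
    (hmul : ∀ a b, C a → C b → C (a * b)) : C a := by
  obtain ⟨w, rfl⟩ : ∃ w, mk h I w = a := RingQuot.mkAlgHom_surjective ℂ (Rel h I) a
  induction w using FreeAlgebra.induction with
  | grade0 c => rw [AlgHom.commutes]; exact hc c
  | grade1 g => 
    cases g with
    | x i => exact hx i
    | y i => exact hy i
  | mul a b ha hb => rw [map_mul]; exact hmul _ _ ha hb
  | add a b ha hb => rw [map_add]; exact hadd _ _ ha hb

theorem twist_diag (a : HAlg h I) : twist s t p q G a 0 0 = s a ∧ twist s t p q G a 1 0 = 0 ∧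
    twist s t p q G a 1 1 = t a := by
  induction a using induct with
  | hc c => simp [Matrix.algebraMap_matrix_apply]
  | hx i => simp [twist]
  | hy i => simp [twist]
  | hadd a b ha hb => simp [ha, hb]
  | hmul a b ha hb => simp [Matrix.mul_apply, Fin.sum_univ_two, ha, hb]

theorem twistDer_mul (a b : HAlg h I) :
    twistDer s t p q G (a * b) = twistDer s t p q G a * t b + s a * twistDer s t p q G b := by
  have ha := twist_diag s t p q G a
  have hb := twist_diag s t p q G b
  simp only [twistDer, LinearMap.coe_mk, AddHom.coe_mk, map_mul, Matrix.mul_apply,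
    Fin.sum_univ_two, ha, hb]
  abel
end

theorem goodT_of (s t : HAlg h I →ₐ[ℂ] HAlg h I) (p q : I → HAlg h I)
    (yy : ∀ i j, q j * t (Y h i) + s (Y h j) * q i = q i * t (Y h j) + s (Y h i) * q j)
    (xy : ∀ i j, p j * t (Y h i) + s (X h j) * q i = q i * t (X h j) + s (Y h i) * p j
      + h • (q i * t (Y h j) + s (Y h i) * q j))
    (xx : ∀ i j, p j * t (X h i) + s (X h j) * p i = p i * t (X h j) + s (X h i) * p j
      - h • (p i * t (Y h j) + s (X h i) * q j) + h • (q i * t (X h j) + s (Y h i) * p j)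
      + h ^ 2 • (q i * t (Y h j) + s (Y h i) * q j)) : GoodT h s t p q := by
  have G := good_XY h (I := I)
  refine ⟨⟨fun i j => ?_, fun i j => ?_, fun i j => ?_⟩⟩
  · ext k l
    fin_cases k <;> fin_cases l <;> simp [Matrix.mul_apply, Fin.sum_univ_two, ← map_mul, G.yy i j]
    linear_combination (norm := module) yy i j
  · ext k l
    fin_cases k <;> fin_cases l <;> simp [Matrix.mul_apply, Fin.sum_univ_two, ← map_mul, G.xy i j]
    linear_combination (norm := module) xy i j
  · ext k l
    fin_cases k <;> fin_cases l <;> simp [Matrix.mul_apply, Fin.sum_univ_two, ← map_mul, G.xx i j]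
    linear_combination (norm := module) xx i j

variable (h I) in
/-- The operator `F`: `F x_i = y_i`, `F y_i = 0`, `F (a b) = F (a) b + a F (b)`. -/
noncomputable def opF : HAlg h I →ₗ[ℂ] HAlg h I :=
  twistDer (AlgHom.id ℂ _) (AlgHom.id ℂ _) (fun i => Y h i) (fun _ => 0) (by
    have G := good_XY h (I := I)
    refine goodT_of _ _ _ _ (fun i j => ?_) (fun i j => ?_) (fun i j => ?_)
    · simp
    · simp [G.yy i j]
    · simp [G.xy i j, G.xy j i, G.yy i j]
      module)

variable (h I) in
/-- The operator `E`: `E x_i = 0`, `E y_i = x_i`,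
`E (a b) = E (a) e^{-hF} (b) + e^{hF} (a) E (b)`. -/
noncomputable def opE : HAlg h I →ₗ[ℂ] HAlg h I :=
  twistDer (expF h h) (expF h (-h)) (fun _ => 0) (fun i => X h i) (by
    have G := good_XY h (I := I)
    refine goodT_of _ _ _ _ (fun i j => ?_) (fun i j => ?_) (fun i j => ?_)
    · simp [expF, G.xy j i, G.xy i j, G.yy i j]
      module
    · simp [expF, G.xy j i, G.yy i j, G.xx i j, mul_add, add_mul]
      module
    · simp [expF, G.xy j i, G.yy i j, mul_add, add_mul]
      module)

variable (h I) in
/-- The operator `H`: `H x_i = x_i`, `H y_i = - y_i`,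
`H (a b) = H (a) e^{-hF} (b) + e^{hF} (a) H (b)`. -/
noncomputable def opH : HAlg h I →ₗ[ℂ] HAlg h I :=
  twistDer (expF h h) (expF h (-h)) (fun i => X h i) (fun i => - Y h i) (by
    have G := good_XY h (I := I)
    refine goodT_of _ _ _ _ (fun i j => ?_) (fun i j => ?_) (fun i j => ?_)
    · simp [expF, G.yy i j]
    · simp [expF, G.xy i j, G.yy i j, mul_add, add_mul]
    · simp [expF, G.xy j i, G.xy i j, G.yy i j, G.xx i j, mul_add, add_mul]
      module)


variable (h) in
/-- The polarization operator `Δ_{kl}`: the derivation with `x_k ↦ x_l`, `y_k ↦ y_l` that kills the other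
variables. -/
noncomputable def polD (k l : I) : HAlg h I →ₗ[ℂ] HAlg h I :=
  twistDer (AlgHom.id ℂ _) (AlgHom.id ℂ _) (fun i => if i = k then X h l else 0)
    (fun i => if i = k then Y h l else 0) (by
    have G := good_XY h (I := I)
    have e : ∀ (i : I) (z : HAlg h I), (if i = k then z else 0) =
      (if i = k then (1 : ℂ) else 0) • z := fun i z => by split_ifs <;> simp
    refine goodT_of _ _ _ _ (fun i j => ?_) (fun i j => ?_) (fun i j => ?_) <;>
      simp only [e, AlgHom.id_apply, smul_mul_assoc, mul_smul_comm] <;>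
      generalize (if i = k then (1 : ℂ) else 0) = u <;>
      generalize (if j = k then (1 : ℂ) else 0) = v
    · rw [G.yy i l, G.yy l j]; module
    · rw [G.xy i l, G.xy l j]; module
    · rw [G.xx i l, G.xx l j]; module)

theorem expF_X (t : ℂ) (i : I) : expF h t (X h i) = X h i + t • Y h i := by simp [expF]
theorem expF_Y (t : ℂ) (i : I) : expF h t (Y h i) = Y h i := by simp [expF]

variable (h) in
/-- The homomorphism `H_I → H_I[T]` that multiplies `x_k`, `y_k` by `T`. The coefficient of `T^n` in
`degHom h k a` is the component of `a` that is homogeneous of degree `n` with respect to `k`. -/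
noncomputable def degHom (k : I) : HAlg h I →ₐ[ℂ] Polynomial (HAlg h I) :=
  lift (fun i => Polynomial.monomial (if i = k then 1 else 0) (X h i))
    (fun i => Polynomial.monomial (if i = k then 1 else 0) (Y h i)) (by
    have G := good_XY h (I := I)
    refine ⟨fun i j => ?_, fun i j => ?_, fun i j => ?_⟩ <;>
      generalize (if i = k then 1 else 0) = u <;>
      generalize (if j = k then 1 else 0) = v <;>
      simp only [Polynomial.monomial_mul_monomial, Polynomial.smul_monomial, add_comm v u,
        ← map_add, ← map_sub]
    · rw [G.yy i j]
    · rw [G.xy i j]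
    · rw [G.xx i j])

variable (h) in
/-- The operator `P_{ij}`: it is `(1/n) Δ_{ij}` on elements of degree `n` with respect to the index `i`
(and zero on elements of degree zero). -/
noncomputable def polP (i j : I) : HAlg h I →ₗ[ℂ] HAlg h I where
  toFun a := (degHom h i a).sum fun n c => (n : ℂ)⁻¹ • polD h i j c
  map_add' a b := by
    rw [map_add, Polynomial.sum_add_index] <;> simp
  map_smul' c a := by
    rw [map_smul, Polynomial.sum_smul_index' _ _ _ (by simp)]
    simp [Polynomial.sum, Finset.smul_sum, smul_comm c]

theorem polP_of_homog (i j : I) (n : ℕ) (a : HAlg h I)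
    (ha : degHom h i a = Polynomial.monomial n a) :
    polP h i j a = (n : ℂ)⁻¹ • polD h i j a := by
  simp [polP, ha]


theorem opF_mul (a b : HAlg h I) : opF h I (a * b) = opF h I a * b + a * opF h I b :=
  twistDer_mul _ _ _ _ _ a b

theorem opE_mul (a b : HAlg h I) :
    opE h I (a * b) = opE h I a * expF h (-h) b + expF h h a * opE h I b :=
  twistDer_mul _ _ _ _ _ a b

theorem opH_mul (a b : HAlg h I) :
    opH h I (a * b) = opH h I a * expF h (-h) b + expF h h a * opH h I b :=
  twistDer_mul _ _ _ _ _ a b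

theorem polD_mul (k l : I) (a b : HAlg h I) :
    polD h k l (a * b) = polD h k l a * b + a * polD h k l b :=
  twistDer_mul _ _ _ _ _ a b

theorem action_gen (i : I) :
    opH h I (X h i) = X h i ∧ opH h I (Y h i) = - Y h i ∧ opE h I (X h i) = 0 ∧
      opE h I (Y h i) = X h i ∧ opF h I (X h i) = Y h i ∧ opF h I (Y h i) = 0 := by
  simp [opE, opF, opH]

theorem action_one : opH h I 1 = 0 ∧ opE h I 1 = 0 ∧ opF h I 1 = 0 := by
  refine ⟨?_, ?_, ?_⟩ <;> simp [opE, opF, opH, twistDer]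

variable (h I) in
/-- The homomorphism `e^{TF}` with a formal parameter `T`. -/
noncomputable def expT : HAlg h I →ₐ[ℂ] Polynomial (HAlg h I) :=
  lift (fun i => Polynomial.monomial 0 (X h i) + Polynomial.monomial 1 (Y h i))
    (fun i => Polynomial.monomial 0 (Y h i)) (by
    have G := good_XY h (I := I)
    refine ⟨fun i j => ?_, fun i j => ?_, fun i j => ?_⟩ <;>
      simp only [Polynomial.monomial_mul_monomial, add_mul, mul_add, smul_add,
        Polynomial.smul_monomial, add_zero, zero_add, G.xx i j, G.xy i j, G.xy j i, G.yy i j,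
        map_add, map_sub]
    · abel
    · abel)

theorem derivative_expT (a : HAlg h I) :
    Polynomial.derivative (expT h I a) = expT h I (opF h I a) := by
  induction a using induct with
  | hc c => 
    rw [Algebra.algebraMap_eq_smul_one, map_smul (expT h I), map_smul (opF h I),
      Polynomial.derivative_smul,
      action_one.2.2, map_one, Polynomial.derivative_one, smul_zero, smul_zero, map_zero]
  | hx i => simp [expT, opF]
  | hy i => simp [expT, opF]
  | hadd a b ha hb => simp [ha, hb]
  | hmul a b ha hb => simp [Polynomial.derivative_mul, ha, hb, opF_mul]

theorem expF_eq_eval (t : ℂ) (a : HAlg h I) :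
    expF h t a = (expT h I a).eval (algebraMap ℂ _ t) := by
  induction a using induct with
  | hc c => 
    rw [AlgHom.commutes, AlgHom.commutes, Polynomial.algebraMap_apply, Polynomial.eval_C]
  | hx i => simp [expT, expF, Polynomial.eval_monomial, Algebra.smul_def,
      (Algebra.commutes t (Y h i)).symm]
  | hy i => simp [expT, expF]
  | hadd a b ha hb => simp [ha, hb]
  | hmul a b ha hb => 
    rw [map_mul, map_mul, Polynomial.eval, Polynomial.eval₂_mul_noncomm, ha, hb]
    · rfl
    · intro k
      exact (Algebra.commutes t _).symm

/-- `expF t` really is `e^{tF}`, and `F` is locally nilpotent. -/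
theorem expF_eq_sum (a : HAlg h I) : ∃ N : ℕ, (∀ n, N ≤ n → (opF h I)^[n] a = 0) ∧
    ∀ t : ℂ, expF h t a = ∑ k ∈ Finset.range N, (t ^ k / (k.factorial : ℂ)) • (opF h I)^[k] a := by
  have key : ∀ (k : ℕ) (a : HAlg h I),
      (k.factorial : ℂ) • (expT h I a).coeff k = (opF h I)^[k] a := by
    intro k
    induction k with
    | zero =>
      intro a
      have := expF_eq_eval 0 a
      rw [map_zero, ← Polynomial.coeff_zero_eq_eval_zero] at this
      have h1 : expF h 0 = AlgHom.id ℂ (HAlg h I) := hom_ext (by simp [expF]) (by simp [expF])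
      rw [h1] at this
      simpa using this.symm
    | succ k ih =>
      intro a
      rw [Function.iterate_succ_apply, ← ih, ← derivative_expT, Polynomial.coeff_derivative,
        Nat.factorial_succ, Nat.cast_mul, mul_comm, mul_smul, ← Nat.cast_succ, ← nsmul_eq_mul',
        Nat.cast_smul_eq_nsmul ℂ (k + 1)]
  refine ⟨(expT h I a).natDegree + 1, fun n hn => ?_, fun t => ?_⟩
  · rw [← key, Polynomial.coeff_eq_zero_of_natDegree_lt (by omega), smul_zero]
  · rw [expF_eq_eval, Polynomial.eval_eq_sum_range]
    refine Finset.sum_congr rfl fun k _ => ?_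
    have : (k.factorial : ℂ) ≠ 0 := by exact_mod_cast k.factorial_ne_zero
    rw [← key, smul_smul, div_mul_cancel₀ _ this, ← map_pow, Algebra.smul_def, Algebra.commutes]

/-! ### The quotient division ring `Q_I`

`H_I` has no zero divisors and satisfies both Ore conditions, so that it has a division ring of
fractions. -/

set_option linter.unusedSectionVars false
set_option linter.unusedSimpArgs false
set_option linter.unusedTactic false
set_option linter.unreachableTactic false

section Quot

open Polynomial (coeff natDegree)

/-- The index of a variable. -/
def Gen.idx {I : Type*} : Gen I → I
  | Gen.x i => i
  | Gen.y i => i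

/-- The degree in the `x`-variables. -/
def Gen.xdeg {I : Type*} : Gen I → ℕ
  | Gen.x _ => 1
  | Gen.y _ => 0

variable (h) in
/-- A variable as an element of `H_I`. -/
noncomputable def gen : Gen I → HAlg h I
  | Gen.x i => X h i
  | Gen.y i => Y h i

variable (h) in
/-- The product of a word. -/
noncomputable def pr (w : List (Gen I)) : HAlg h I := (w.map (gen h)).prod

/-- The number of letters `x` in a word. -/
def xc (w : List (Gen I)) : ℕ := (w.map Gen.xdeg).sum

variable (h) in
/-- The span of the words of length at most `n` with indices in `S` and less than `k` letters `x`. -/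
noncomputable def U (S : Finset I) (n k : ℕ) : Submodule ℂ (HAlg h I) :=
  Submodule.span ℂ {a | ∃ w : List (Gen I), pr h w = a ∧ xc w < k ∧ w.length ≤ n ∧
    ∀ g ∈ w, g.idx ∈ S}

theorem pr_mem {S : Finset I} {n k : ℕ} {w : List (Gen I)} (hk : xc w < k) (hn : w.length ≤ n)
    (hS : ∀ g ∈ w, g.idx ∈ S) : pr h w ∈ U h S n k :=
  Submodule.subset_span ⟨w, rfl, hk, hn, hS⟩

theorem pr_cons (g : Gen I) (w : List (Gen I)) : pr h (g :: w) = gen h g * pr h w := by simp [pr]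
theorem pr_append (v w : List (Gen I)) : pr h (v ++ w) = pr h v * pr h w := by simp [pr]
theorem xc_cons (g : Gen I) (w : List (Gen I)) : xc (g :: w) = g.xdeg + xc w := by simp [xc]
theorem xc_append (v w : List (Gen I)) : xc (v ++ w) = xc v + xc w := by simp [xc]

theorem xc_le (w : List (Gen I)) : xc w ≤ w.length := by
  induction w with
  | nil => simp [xc]
  | cons g w ih =>
    rw [xc_cons, List.length_cons]
    cases g <;> simp [Gen.xdeg] <;> omega

theorem U_mono {S S' : Finset I} {n n' k k' : ℕ} (hS : S ⊆ S') (hn : n ≤ n') (hk : k ≤ k') :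
    U h S n k ≤ U h S' n' k' := by
  apply Submodule.span_mono
  rintro _ ⟨w, rfl, h1, h2, h3⟩
  exact ⟨w, rfl, by omega, by omega, fun g hg => hS (h3 g hg)⟩

theorem U_mul {S : Finset I} {n n' k k' : ℕ} {a b : HAlg h I} (ha : a ∈ U h S n (k + 1))
    (hb : b ∈ U h S n' k') : a * b ∈ U h S (n + n') (k + k') := by
  have := Submodule.mul_mem_mul ha hb
  rw [U, U, Submodule.span_mul_span] at this
  refine Submodule.span_mono ?_ this
  rintro _ ⟨_, ⟨v, rfl, h1, h2, h3⟩, _, ⟨w, rfl, h1', h2', h3'⟩, rfl⟩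
  refine ⟨v ++ w, pr_append v w, by rw [xc_append]; omega, by simp; omega, fun g hg => ?_⟩
  rcases List.mem_append.1 hg with hg | hg
  · exact h3 g hg
  · exact h3' g hg

theorem U_mul' {S : Finset I} {n m : ℕ} {a b : HAlg h I} (ha : a ∈ U h S n (n + 1))
    (hb : b ∈ U h S m (m + 1)) : a * b ∈ U h S (n + m) (n + m + 1) := U_mul (k := n) (k' := m + 1) ha hb

theorem pr_perm {v w : List (Gen I)} (hp : v.Perm w) {S : Finset I} {n : ℕ} (hn : v.length ≤ n)
    (hS : ∀ g ∈ v, g.idx ∈ S) : pr h v - pr h w ∈ U h S n (xc v) := by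
  have G := good_XY h (I := I)
  induction hp generalizing n with
  | nil => simp
  | @cons g v w hp ih =>
    rw [List.length_cons] at hn
    rw [pr_cons, pr_cons, ← mul_sub, xc_cons]
    obtain ⟨m, rfl⟩ : ∃ m, n = 1 + m := ⟨n - 1, by omega⟩
    refine U_mul ?_ (ih (by omega) fun g' hg' => hS g' (List.mem_cons_of_mem _ hg'))
    have : gen h g = pr h [g] := by simp [pr]
    rw [this]
    exact pr_mem (by simp [xc]) (by simp) (by simpa using hS g (by simp))
  | swap g g' w =>
    simp only [List.length_cons] at hn
    have hw : ∀ g ∈ w, g.idx ∈ S := fun g'' hg => hS g'' (by simp [hg])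
    have hg : g.idx ∈ S := hS g (by simp)
    have hg' : g'.idx ∈ S := hS g' (by simp)
    simp only [pr_cons, xc_cons]
    cases g with
    | x i =>
      cases g' with
      | x j =>
        have e : gen h (Gen.x j) * (gen h (Gen.x i) * pr h w) -
            gen h (Gen.x i) * (gen h (Gen.x j) * pr h w) =
            (-h) • pr h (Gen.x i :: Gen.y j :: w) + h • pr h (Gen.y i :: Gen.x j :: w) +
              h ^ 2 • pr h (Gen.y i :: Gen.y j :: w) := by
          simp only [pr_cons, gen, ← mul_assoc, G.xx i j, add_mul, sub_mul, smul_mul_assoc]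
          module
        rw [e]
        refine add_mem (add_mem ?_ ?_) ?_ <;> refine Submodule.smul_mem _ _ (pr_mem ?_ ?_ ?_)
        all_goals first | (simp_all [xc_cons, Gen.xdeg, Gen.idx]; done) | (simp [xc_cons, Gen.xdeg]; omega)
      | y j =>
        have e : gen h (Gen.y j) * (gen h (Gen.x i) * pr h w) -
            gen h (Gen.x i) * (gen h (Gen.y j) * pr h w) =
            (-h) • pr h (Gen.y j :: Gen.y i :: w) := by
          simp only [pr_cons, gen, ← mul_assoc, G.xy j i, add_mul, sub_mul, smul_mul_assoc]
          module
        rw [e]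
        refine Submodule.smul_mem _ _ (pr_mem ?_ ?_ ?_)
        all_goals first | (simp_all [xc_cons, Gen.xdeg, Gen.idx]; done) | (simp [xc_cons, Gen.xdeg]; omega)
    | y i =>
      cases g' with
      | x j =>
        have e : gen h (Gen.x j) * (gen h (Gen.y i) * pr h w) -
            gen h (Gen.y i) * (gen h (Gen.x j) * pr h w) =
            h • pr h (Gen.y i :: Gen.y j :: w) := by
          simp only [pr_cons, gen, ← mul_assoc, G.xy i j, add_mul, sub_mul, smul_mul_assoc]
          module
        rw [e]
        refine Submodule.smul_mem _ _ (pr_mem ?_ ?_ ?_)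
        all_goals first | (simp_all [xc_cons, Gen.xdeg, Gen.idx]; done) | (simp [xc_cons, Gen.xdeg]; omega)
      | y j =>
        have e : gen h (Gen.y j) * (gen h (Gen.y i) * pr h w) -
            gen h (Gen.y i) * (gen h (Gen.y j) * pr h w) = 0 := by
          simp only [gen, ← mul_assoc, G.yy i j, sub_self]
        rw [e]; exact zero_mem _
  | @trans u v w h1 h2 ih1 ih2 =>
    have e : xc v = xc u := by
      have := (h1.map Gen.xdeg).sum_eq
      simpa [xc] using this.symm
    have := add_mem (ih1 hn hS) (e ▸ ih2 (h1.length_eq ▸ hn) fun g hg => hS g (h1.mem_iff.2 hg))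
    simpa using this

/-- The derivation of the commutative polynomial ring. -/
noncomputable def dd (h : ℂ) (I : Type*) :
    Derivation ℂ (MvPolynomial (Gen I) ℂ) (MvPolynomial (Gen I) ℂ) :=
  MvPolynomial.mkDerivation ℂ fun g => match g with
    | Gen.x i => (-(h + h)) • MvPolynomial.X (Gen.x i)
    | Gen.y i => h • MvPolynomial.X (Gen.y i)

/-- Multiplication operators. -/
noncomputable abbrev mulOp {I : Type*} (p : MvPolynomial (Gen I) ℂ) :
    Module.End ℂ (MvPolynomial (Gen I) ℂ) := LinearMap.mulLeft ℂ p

theorem rep_good : Good h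
    (fun i : I => Polynomial.monomial 1 (mulOp (MvPolynomial.X (Gen.y i) * MvPolynomial.X (Gen.x i)))
      + Polynomial.C (mulOp (MvPolynomial.X (Gen.y i)) * (dd h I : Module.End ℂ _)))
    (fun i : I => Polynomial.C (mulOp (MvPolynomial.X (Gen.y i)))) := by
  have hx : ∀ i : I, dd h I (MvPolynomial.X (Gen.x i)) = (-(h + h)) • MvPolynomial.X (Gen.x i) :=
    fun i => by simp [dd, MvPolynomial.mkDerivation_X]
  have hy : ∀ i : I, dd h I (MvPolynomial.X (Gen.y i)) = h • MvPolynomial.X (Gen.y i) :=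
    fun i => by simp [dd, MvPolynomial.mkDerivation_X]
  refine ⟨fun i j => ?_, fun i j => ?_, fun i j => ?_⟩
  all_goals
    apply Polynomial.ext
    intro n
    simp only [← Polynomial.monomial_zero_left, add_mul, mul_add, Polynomial.monomial_mul_monomial,
      Polynomial.smul_monomial, Polynomial.coeff_add, Polynomial.coeff_sub, Polynomial.coeff_smul,
      Polynomial.coeff_monomial]
    apply LinearMap.ext
    intro p
    rcases n with _ | _ | _ | n <;>
    simp [Module.End.mul_apply, hx, hy, MvPolynomial.smul_eq_C_mul, smul_add] <;> ring

variable (h I) in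
/-- A representation of `H_I` by differential operators, with a formal parameter that keeps track of
the degree in the `x`-variables. -/
noncomputable def rep : HAlg h I →ₐ[ℂ] Polynomial (Module.End ℂ (MvPolynomial (Gen I) ℂ)) :=
  lift _ _ rep_good

/-- The leading coefficients of `rep`. -/
noncomputable def sym (I : Type*) : MvPolynomial (Gen I) ℂ →ₐ[ℂ] MvPolynomial (Gen I) ℂ :=
  MvPolynomial.aeval fun g => match g with
    | Gen.x i => MvPolynomial.X (Gen.y i) * MvPolynomial.X (Gen.x i)
    | Gen.y i => MvPolynomial.X (Gen.y i)

theorem sym_injective (I : Type*) : Function.Injective (sym I) := by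
  let K := FractionRing (MvPolynomial (Gen I) ℂ)
  let ι := algebraMap (MvPolynomial (Gen I) ℂ) K
  let ψ : MvPolynomial (Gen I) ℂ →ₐ[ℂ] K := MvPolynomial.aeval fun g => match g with
    | Gen.x i => ι (MvPolynomial.X (Gen.x i)) / ι (MvPolynomial.X (Gen.y i))
    | Gen.y i => ι (MvPolynomial.X (Gen.y i))
  have hψ : ψ.comp (sym I) = IsScalarTower.toAlgHom ℂ (MvPolynomial (Gen I) ℂ) K := by
    apply MvPolynomial.algHom_ext
    intro g
    cases g with
    | x i =>
      have : ι (MvPolynomial.X (Gen.y i)) ≠ 0 := by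
        simp [ι]
      simp only [sym, AlgHom.comp_apply, MvPolynomial.aeval_X, map_mul, ψ]
      rw [mul_div_cancel₀ _ this]
      rfl
    | y i => simp [sym, ψ, ι]
  intro p q hpq
  have := congrArg ψ hpq
  rw [← AlgHom.comp_apply, ← AlgHom.comp_apply, hψ] at this
  exact IsFractionRing.injective (MvPolynomial (Gen I) ℂ) K this

variable (h) in
theorem rep_gen (g : Gen I) : natDegree (rep h I (gen h g)) ≤ g.xdeg ∧
    coeff (rep h I (gen h g)) g.xdeg = mulOp (sym I (MvPolynomial.X g)) := by
  cases g with
  | x i =>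
    simp only [rep, gen, lift_X, sym, MvPolynomial.aeval_X, Gen.xdeg]
    refine ⟨?_, ?_⟩
    · refine (Polynomial.natDegree_add_le _ _).trans (max_le (Polynomial.natDegree_monomial_le _) ?_)
      rw [Polynomial.natDegree_C]
      exact Nat.zero_le _
    · simp [Polynomial.coeff_C]
  | y i => simp [rep, gen, sym, Gen.xdeg]

variable (h) in
theorem rep_pr (w : List (Gen I)) : natDegree (rep h I (pr h w)) ≤ xc w ∧
    coeff (rep h I (pr h w)) (xc w) = mulOp (sym I ((w.map MvPolynomial.X).prod)) := by
  induction w with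
  | nil => 
    simp only [pr, xc, List.map_nil, List.prod_nil, List.sum_nil, map_one]
    refine ⟨by simp, ?_⟩
    ext; simp
  | cons g w ih =>
    rw [pr_cons, xc_cons, map_mul]
    have hg := rep_gen h g
    refine ⟨Polynomial.natDegree_mul_le.trans (add_le_add hg.1 ih.1), ?_⟩
    rw [Polynomial.coeff_mul_add_eq_of_natDegree_le hg.1 ih.1, hg.2, ih.2]
    simp [mulOp, Module.End.mul_eq_comp, LinearMap.mulLeft_mul]

variable (h I) in
/-- A monomial goes to the product of its variables in some order. -/
noncomputable def nrm : MvPolynomial (Gen I) ℂ →ₗ[ℂ] HAlg h I :=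
  (MvPolynomial.basisMonomials (Gen I) ℂ).constr ℂ fun m => pr h m.toMultiset.toList

theorem symbol {S : Finset I} {n k : ℕ} {a : HAlg h I} (ha : a ∈ U h S n (k + 1)) :
    natDegree (rep h I a) ≤ k ∧ ∃ P, coeff (rep h I a) k = mulOp (sym I P) ∧
      (P = 0 → a ∈ U h S n k) := by
  suffices natDegree (rep h I a) ≤ k ∧ ∃ P, coeff (rep h I a) k = mulOp (sym I P) ∧
      a - nrm h I P ∈ U h S n k by
    obtain ⟨h1, P, h2, h3⟩ := this
    refine ⟨h1, P, h2, ?_⟩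
    rintro rfl
    simpa using h3
  induction ha using Submodule.span_induction with
  | mem a ha =>
    obtain ⟨w, rfl, h1, h2, h3⟩ := ha
    have hw := rep_pr h w
    refine ⟨hw.1.trans (by omega), ?_⟩
    rcases Nat.lt_succ_iff_lt_or_eq.1 h1 with h1 | rfl
    · refine ⟨0, ?_, ?_⟩
      · rw [Polynomial.coeff_eq_zero_of_natDegree_lt (by omega)]
        simp [mulOp]
      · simpa using pr_mem h1 h2 h3
    · classical
      refine ⟨MvPolynomial.monomial (Multiset.toFinsupp (w : Multiset (Gen I))) 1, ?_, ?_⟩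
      · rw [hw.2]
        congr 2
        clear hw h1 h2 h3
        induction w with
        | nil => simp
        | cons g w ih =>
          rw [List.map_cons, List.prod_cons, ih, ← Multiset.cons_coe, ← Multiset.singleton_add,
            map_add, Multiset.toFinsupp_singleton, MvPolynomial.X, MvPolynomial.monomial_mul, one_mul]
      · have : nrm h I (MvPolynomial.monomial (Multiset.toFinsupp (w : Multiset (Gen I))) 1) =
            pr h (w : Multiset (Gen I)).toList := by
          have e : MvPolynomial.monomial (Multiset.toFinsupp (w : Multiset (Gen I))) (1 : ℂ) =
              MvPolynomial.basisMonomials (Gen I) ℂ (Multiset.toFinsupp (w : Multiset (Gen I))) := by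
            rw [MvPolynomial.coe_basisMonomials]
          rw [nrm, e, Module.Basis.constr_basis, Multiset.toFinsupp_toMultiset]
        rw [this]
        exact pr_perm (Multiset.coe_eq_coe.1 (by simp)) h2 h3
  | zero => exact ⟨by simp, 0, by simp [mulOp], by simp⟩
  | add a b _ _ ha hb =>
    obtain ⟨h1, P, h2, h3⟩ := ha
    obtain ⟨h1', P', h2', h3'⟩ := hb
    refine ⟨?_, P + P', ?_, ?_⟩
    · rw [map_add]
      exact (Polynomial.natDegree_add_le _ _).trans (max_le h1 h1')
    · rw [map_add, Polynomial.coeff_add, h2, h2', map_add]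
      ext; simp [add_mul]
    · have := add_mem h3 h3'
      rw [map_add]
      convert this using 1
      abel
  | smul c a _ ha =>
    obtain ⟨h1, P, h2, h3⟩ := ha
    refine ⟨?_, c • P, ?_, ?_⟩
    · rw [map_smul]
      exact (Polynomial.natDegree_smul_le _ _).trans h1
    · rw [map_smul, Polynomial.coeff_smul, h2, map_smul]
      ext; simp
    · rw [map_smul, ← smul_sub]
      exact Submodule.smul_mem _ _ h3

theorem U_zero (S : Finset I) (n : ℕ) : U h S n 0 = ⊥ := by
  simp [U]

theorem exists_mem_U (a : HAlg h I) : ∃ S n, a ∈ U h S n (n + 1) := by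
  classical
  induction a using induct with
  | hc c =>
    refine ⟨∅, 0, ?_⟩
    rw [Algebra.algebraMap_eq_smul_one]
    exact Submodule.smul_mem _ _ (pr_mem (w := []) (by simp [xc]) (by simp) (by simp))
  | hx i =>
    refine ⟨{i}, 1, ?_⟩
    have : X h i = pr h [Gen.x i] := by simp [pr, gen]
    rw [this]
    exact pr_mem (by simp [xc, Gen.xdeg]) (by simp) (by simp [Gen.idx])
  | hy i =>
    refine ⟨{i}, 1, ?_⟩
    have : Y h i = pr h [Gen.y i] := by simp [pr, gen]
    rw [this]
    exact pr_mem (by simp [xc, Gen.xdeg]) (by simp) (by simp [Gen.idx])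
  | hadd a b ha hb =>
    obtain ⟨S, n, ha⟩ := ha
    obtain ⟨S', n', hb⟩ := hb
    exact ⟨S ∪ S', n + n', add_mem (U_mono (by simp) (by omega) (by omega) ha)
      (U_mono (by simp) (by omega) (by omega) hb)⟩
  | hmul a b ha hb =>
    obtain ⟨S, n, ha⟩ := ha
    obtain ⟨S', n', hb⟩ := hb
    have ha' : a ∈ U h (S ∪ S') n (n + 1) := U_mono (by simp) le_rfl le_rfl ha
    have hb' : b ∈ U h (S ∪ S') n' (n' + 1) := U_mono (by simp) le_rfl le_rfl hb
    exact ⟨S ∪ S', n + n', U_mul' ha' hb'⟩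

theorem exists_lead {a : HAlg h I} (ha : a ≠ 0) : ∃ k s, natDegree (rep h I a) ≤ k ∧
    coeff (rep h I a) k = mulOp s ∧ s ≠ 0 := by
  obtain ⟨S, n, hn⟩ := exists_mem_U a
  generalize n + 1 = k at hn
  induction k with
  | zero => rw [U_zero] at hn; exact absurd hn ha
  | succ k ih =>
    obtain ⟨h1, P, h2, h3⟩ := symbol hn
    by_cases hP : P = 0
    · exact ih (h3 hP)
    · exact ⟨k, sym I P, h1, h2, by simpa using (sym_injective I).ne hP⟩

instance : Nontrivial (HAlg h I) := (rep h I).toRingHom.domain_nontrivial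

instance : NoZeroDivisors (HAlg h I) where
  eq_zero_or_eq_zero_of_mul_eq_zero := by
    intro a b hab
    by_contra! hne
    obtain ⟨k, s, h1, h2, h3⟩ := exists_lead hne.1
    obtain ⟨k', s', h1', h2', h3'⟩ := exists_lead hne.2
    have := Polynomial.coeff_mul_add_eq_of_natDegree_le h1 h1'
    rw [← map_mul, hab, h2, h2', map_zero, Polynomial.coeff_zero] at this
    have := LinearMap.congr_fun this 1
    simp at this
    tauto

open Classical in
theorem finrank_U_le (S : Finset I) (n k : ℕ) : Module.Finite ℂ (U h S n k) ∧
    Module.finrank ℂ (U h S n k) ≤ (n + 1) ^ (2 * S.card) := by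
  let L : Finset (Gen I) := S.image Gen.x ∪ S.image Gen.y
  let F : Finset (HAlg h I) := (L.finsupp fun _ => Finset.range (n + 1)).image
    fun m => pr h m.toMultiset.toList
  have hF : F.card ≤ (n + 1) ^ (2 * S.card) := by
    refine Finset.card_image_le.trans ?_
    rw [Finset.card_finsupp, Finset.prod_const, Finset.card_range]
    refine Nat.pow_le_pow_right (by omega) ((Finset.card_union_le _ _).trans ?_)
    have h1 := Finset.card_image_le (s := S) (f := Gen.x)
    have h2 := Finset.card_image_le (s := S) (f := Gen.y)
    omega
  have hle : U h S n k ≤ Submodule.span ℂ (F : Set (HAlg h I)) := by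
    induction k with
    | zero => rw [U_zero]; exact bot_le
    | succ k ih =>
      refine Submodule.span_le.2 ?_
      rintro _ ⟨w, rfl, h1, h2, h3⟩
      have hp := pr_perm (h := h) (v := w) (w := (w : Multiset (Gen I)).toList)
        (Multiset.coe_eq_coe.1 (by simp)) h2 h3
      have h4 := ih (U_mono le_rfl le_rfl (by omega) hp)
      have h5 : pr h (w : Multiset (Gen I)).toList ∈ Submodule.span ℂ (F : Set (HAlg h I)) := by
        apply Submodule.subset_span
        rw [Finset.mem_coe, Finset.mem_image]
        refine ⟨Multiset.toFinsupp (w : Multiset (Gen I)), ?_, by simp⟩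
        rw [Finset.mem_finsupp_iff]
        refine ⟨fun g hg => ?_, fun g _ => ?_⟩
        · have : g ∈ w := by simpa using hg
          have := h3 g this
          cases g <;> simp_all [L, Gen.idx]
        · have := List.count_le_length (a := g) (l := w)
          simp; omega
      simpa using add_mem h4 h5
  have hfin : Module.Finite ℂ (Submodule.span ℂ (F : Set (HAlg h I))) :=
    Module.Finite.span_finset _ _
  exact ⟨Submodule.finiteDimensional_of_le hle,
    (Submodule.finrank_mono hle).trans ((finrank_span_finset_le_card F).trans hF)⟩

theorem growth (c d : ℕ) : ∃ j : ℕ, (j * d + 1) ^ c < 2 ^ j := by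
  have h1 := tendsto_pow_const_div_const_pow_of_one_lt c (r := (2 : ℝ)) (by norm_num)
  have h2 := h1.const_mul ((d + 1 : ℝ) ^ c)
  rw [mul_zero] at h2
  obtain ⟨j, hj, hj1⟩ := ((h2.eventually_lt_const one_pos).and (Filter.eventually_ge_atTop 1)).exists
  refine ⟨j, ?_⟩
  have h3 : ((d + 1 : ℝ) ^ c) * (j : ℝ) ^ c < 2 ^ j := by
    rwa [← mul_div_assoc, div_lt_one (by positivity)] at hj
  have h4 : ((d + 1) ^ c) * j ^ c < 2 ^ j := by exact_mod_cast h3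
  refine lt_of_le_of_lt ?_ h4
  rw [← mul_pow]
  exact Nat.pow_le_pow_left (by nlinarith) _

theorem exists_ker (a b : HAlg h I) (Φ : HAlg h I × HAlg h I →ₗ[ℂ] HAlg h I)
    (hΦ : ∀ S n d, a ∈ U h S d (d + 1) → b ∈ U h S d (d + 1) → ∀ p ∈ U h S n (n + 1),
      ∀ q ∈ U h S n (n + 1), Φ (p, q) ∈ U h S (n + d) (n + d + 1)) :
    ∃ z, z ≠ 0 ∧ Φ z = 0 := by
  classical
  by_contra! hne
  have hinj : Function.Injective Φ := by
    rw [← LinearMap.ker_eq_bot, LinearMap.ker_eq_bot']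
    intro z hz
    by_contra h0
    exact hne z h0 hz
  obtain ⟨S₁, n₁, ha⟩ := exists_mem_U a
  obtain ⟨S₂, n₂, hb⟩ := exists_mem_U b
  let S := S₁ ∪ S₂
  let d := n₁ + n₂
  have ha' : a ∈ U h S d (d + 1) := U_mono (by simp [S]) (by omega) (by omega) ha
  have hb' : b ∈ U h S d (d + 1) := U_mono (by simp [S]) (by omega) (by omega) hb
  have hfin : ∀ n, Module.Finite ℂ (U h S n (n + 1)) := fun n => (finrank_U_le S n _).1
  have hstep : ∀ n, 2 * Module.finrank ℂ (U h S n (n + 1)) ≤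
      Module.finrank ℂ (U h S (n + d) (n + d + 1)) := by
    intro n
    have := hfin n
    have := hfin (n + d)
    let Ψ : (U h S n (n + 1)) × (U h S n (n + 1)) →ₗ[ℂ] U h S (n + d) (n + d + 1) :=
      (Φ ∘ₗ ((U h S n (n + 1)).subtype.prodMap (U h S n (n + 1)).subtype)).codRestrict _
        (fun z => hΦ S n d ha' hb' _ z.1.2 _ z.2.2)
    have hΨ : Function.Injective Ψ := by
      intro z z' hz
      have := hinj (congrArg Subtype.val hz)
      simp only [LinearMap.prodMap_apply, Prod.mk.injEq] at this
      exact Prod.ext (Subtype.ext this.1) (Subtype.ext this.2)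
    have := LinearMap.finrank_le_finrank_of_injective hΨ
    rw [Module.finrank_prod] at this
    omega
  have hpow : ∀ j, 2 ^ j ≤ Module.finrank ℂ (U h S (j * d) (j * d + 1)) := by
    intro j
    induction j with
    | zero =>
      have := hfin (0 * d)
      rw [pow_zero, Nat.one_le_iff_ne_zero, ← Nat.pos_iff_ne_zero, Module.finrank_pos_iff]
      refine ⟨⟨1, pr_mem (w := []) (by simp [xc]) (by simp) (by simp)⟩, 0, ?_⟩
      simp [Subtype.ext_iff]
    | succ j ih =>
      have := hstep (j * d)
      rw [pow_succ, Nat.succ_mul]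
      omega
  obtain ⟨j, hj⟩ := growth (2 * S.card) d
  exact absurd ((hpow j).trans (finrank_U_le S _ _).2) (by omega)

theorem ore_left (r s : HAlg h I) (hs : s ≠ 0) : ∃ p q, p ≠ 0 ∧ p * r = q * s := by
  obtain ⟨z, hz, hz0⟩ := exists_ker r s
    ((LinearMap.mulRight ℂ r).coprod (LinearMap.mulRight ℂ s))
    (fun S n d ha hb p hp q hq => add_mem (U_mul' hp ha) (U_mul' hq hb))
  simp only [LinearMap.coprod_apply, LinearMap.mulRight_apply] at hz0
  refine ⟨z.1, -z.2, fun h0 => hz ?_, by rw [neg_mul]; exact eq_neg_of_add_eq_zero_left hz0⟩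
  rw [h0, zero_mul, zero_add] at hz0
  exact Prod.ext h0 ((mul_eq_zero.1 hz0).resolve_right hs)

theorem ore_right (r s : HAlg h I) (hs : s ≠ 0) : ∃ p q, p ≠ 0 ∧ r * p = s * q := by
  obtain ⟨z, hz, hz0⟩ := exists_ker r s
    ((LinearMap.mulLeft ℂ r).coprod (LinearMap.mulLeft ℂ s))
    (fun S n d ha hb p hp q hq => by
      rw [add_comm n d]
      exact add_mem (U_mul' ha hp) (U_mul' hb hq))
  simp only [LinearMap.coprod_apply, LinearMap.mulLeft_apply] at hz0
  refine ⟨z.1, -z.2, fun h0 => hz ?_, by rw [mul_neg]; exact eq_neg_of_add_eq_zero_left hz0⟩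
  rw [h0, mul_zero, zero_add] at hz0
  exact Prod.ext h0 ((mul_eq_zero.1 hz0).resolve_left hs)

open scoped nonZeroDivisors

noncomputable instance : OreLocalization.OreSet (HAlg h I)⁰ where
  ore_right_cancel r₁ r₂ s hs := ⟨1, by
    have := mul_right_cancel₀ (nonZeroDivisors.ne_zero s.2) hs
    rw [this]⟩
  oreNum r s := (ore_left r s.1 (nonZeroDivisors.ne_zero s.2)).choose_spec.choose
  oreDenom r s := ⟨(ore_left r s.1 (nonZeroDivisors.ne_zero s.2)).choose,
    mem_nonZeroDivisors_of_ne_zero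
      (ore_left r s.1 (nonZeroDivisors.ne_zero s.2)).choose_spec.choose_spec.1⟩
  ore_eq r s := (ore_left r s.1 (nonZeroDivisors.ne_zero s.2)).choose_spec.choose_spec.2

variable (h I) in
/-- The quotient division ring `Q_I` of `H_I`. -/
abbrev QRing : Type _ := OreLocalization (HAlg h I)⁰ (HAlg h I)

variable (h I) in
/-- The embedding of `H_I` in `Q_I`. -/
noncomputable def toQ : HAlg h I →+* QRing h I := OreLocalization.numeratorRingHom

theorem toQ_injective : Function.Injective (toQ h I) :=
  OreLocalization.numeratorHom_inj fun _ hs => hs.1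

/-- The elements of `Q_I` are the right quotients `a b⁻¹`. -/
theorem exists_eq_mul_inv (q : QRing h I) : ∃ a b : HAlg h I, b ≠ 0 ∧
    q = toQ h I a * (toQ h I b)⁻¹ := by
  have hinj := toQ_injective (h := h) (I := I)
  induction q using OreLocalization.ind with
  | _ r s =>
    have hs := nonZeroDivisors.ne_zero s.2
    obtain ⟨p, q, hp, hpq⟩ := ore_right r s.1 hs
    refine ⟨q, p, hp, ?_⟩
    have hp' : toQ h I p ≠ 0 := (map_ne_zero_iff _ hinj).2 hp
    have hs' : toQ h I s ≠ 0 := (map_ne_zero_iff _ hinj).2 hs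
    have e : toQ h I s.1 * (r /ₒ s) = toQ h I r := OreLocalization.mul_cancel (t := 1)
    rw [eq_mul_inv_iff_mul_eq₀ hp']
    apply mul_left_cancel₀ hs'
    rw [← mul_assoc, e, ← map_mul, ← map_mul, hpq]

end Quot

/-! ### Invariants, forms, covariants -/

/-- Invariant elements of `H_I`. -/
def IsInvariant (v : HAlg h I) : Prop := opE h I v = 0 ∧ opF h I v = 0 ∧ opH h I v = 0

variable (h) in
/-- The bracket `(ij) = x_i y_j - y_i x_j - h y_i y_j`. -/
noncomputable def bracket (i j : I) : HAlg h I :=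
  X h i * Y h j - Y h i * X h j - h • (Y h i * Y h j)

variable (h) in
/-- The subalgebra of `H_I` generated by the `x_i`, `y_i` with `i ∈ I \ S`. -/
noncomputable def without (S : Set I) : Subalgebra ℂ (HAlg h I) :=
  Algebra.adjoin ℂ {a | ∃ i, i ∉ S ∧ (a = X h i ∨ a = Y h i)}

/-- `f` is an `n`-form in the variables `x_i`, `y_i`: a nonvanishing invariant element
`∑ k, (n choose k) x_i^{n-k} y_i^k A_k` with coefficients `A_k` that do not involve `x_i`, `y_i`. -/
def IsForm (i : I) (n : ℕ) (f : HAlg h I) : Prop :=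
  f ≠ 0 ∧ IsInvariant f ∧ ∃ A : Fin (n + 1) → HAlg h I, (∀ k, A k ∈ without h {i}) ∧
    f = ∑ k : Fin (n + 1),
      (n.choose k : ℂ) • (X h i ^ (n - (k : ℕ)) * Y h i ^ (k : ℕ) * A k)

/-- The value of the noncommutative polynomial `C` at `A_0, …, A_n, x_i, y_i`. -/
noncomputable def polyEval {n : ℕ} (C : FreeAlgebra ℂ (Fin (n + 1) ⊕ Fin 2))
    (A : Fin (n + 1) → HAlg h I) (i : I) : HAlg h I :=
  FreeAlgebra.lift ℂ (Sum.elim A ![X h i, Y h i]) C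

end NCForm

namespace NCForm

variable {h : ℂ} {I : Type*} [LinearOrder I]

/-! ### Commutation relations -/

/-! Write `v_i` for the pair `x_i, y_i`, regard `f` as a function `f(v_0)` of its variables, and put
`f_1 = f(v_1)`. For commuting variables the identity is Euler's formula combined with Cramer's rule:
with `ξ = P_10 f_1`, the elements `x_0 f_1 - x_1 ξ` and `y_0 f_1 - y_1 ξ` are multiples of the
determinant `η = (01)`. Replacing `x_0 f_1` and `y_0 f_1` accordingly in `f_1^n f = f(x_0 f_1, y_0
f_1)` and expanding in `ξ` and `η` gives the result. Three facts carry this argument over to `H_I`.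

Invariants are central (`IsInvariant.mem_center`): commuting a generator past `a` produces only
`e^{±hF}(a)` and `H(a)`. Polarization commutes with `E`, `F`, `H`, so `f_1` and `ξ` are invariant
along with `f`. Hence `f_1`, `ξ`, `η` behave as scalars, and the substitution and the expansion go
through for noncommuting coefficients (`formAt_pow_mul_formAt`).

The relations in the form `Good` ignore the order of the indices and even their distinctness.
Therefore indices may be renamed or identified (`reindex`), `e^{TΔ}` is an algebra homomorphism
(`polT`), and a polynomial in `v_j` moves past `v_i` by a rule independent of `i`, `j` and `I`. The
last point yields Euler's formula with a universal remainder, by induction on the degree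
(`EulerIdentity.mul_ι`, `exists_linear_factors`), and so makes the `C_k` depend on `n` and `h` only.

The covariance of the `u_k` follows from uniqueness, without computing them. Identifying the index 0
with 1 kills `η`, sends `ξ` to `f_1 ≠ 0` and fixes everything that does not involve 0; since `H_I`
is a domain, the monomials `ξ^{n-k} η^k` are independent over `H_{I∖{0}}`
(`eq_zero_of_sum_pow_mul_pow`). Applying `E`, `F`, `H` or the grading by the index 1 to `f_1^n f = ∑
ξ^{n-k} η^k u_k` and comparing coefficients shows that each `u_k` is invariant and homogeneous. A
nonzero homogeneous invariant is a form (`IsHomog.isForm`), because its variables can be sorted to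
the left. -/

/-- Both sides are compatible with products in `a`, since `e^{-hF}` is multiplicative; generators
suffice. -/
theorem Y_mul (i : I) (a : HAlg h I) : Y h i * a = expF h (-h) a * Y h i := by
  have G := good_XY h (I := I)
  induction a using induct with
  | hc c => rw [AlgHom.commutes]; exact (Algebra.commutes c _).symm
  | hx j => rw [expF_X, add_mul, G.xy i j, smul_mul_assoc, G.yy i j]; module
  | hy j => rw [expF_Y, G.yy]
  | hadd a b ha hb => rw [mul_add, ha, hb, map_add, add_mul]
  | hmul a b ha hb => rw [← mul_assoc, ha, mul_assoc, hb, map_mul, mul_assoc]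

theorem opH_algebraMap (c : ℂ) : opH h I (algebraMap ℂ _ c) = 0 := by
  rw [Algebra.algebraMap_eq_smul_one, map_smul, action_one.1, smul_zero]

theorem opE_algebraMap (c : ℂ) : opE h I (algebraMap ℂ _ c) = 0 := by
  rw [Algebra.algebraMap_eq_smul_one, map_smul, action_one.2.1, smul_zero]

theorem opF_algebraMap (c : ℂ) : opF h I (algebraMap ℂ _ c) = 0 := by
  rw [Algebra.algebraMap_eq_smul_one, map_smul, action_one.2.2, smul_zero]

/-- The shift by `(h/2) y_i` absorbs the `h^2` term of the `xx` relation. What remains is compatible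
with products precisely because `H` obeys its twisted Leibniz rule, the factor `e^{-hF}` arising
from moving `y_i` by `Y_mul`. -/
theorem X_add_mul (i : I) (a : HAlg h I) : (X h i + (h / 2) • Y h i) * a =
    expF h h a * (X h i + (h / 2) • Y h i) - h • (opH h I a * Y h i) := by
  have G := good_XY h (I := I)
  induction a using induct with
  | hc c =>
    rw [AlgHom.commutes, opH_algebraMap, zero_mul, smul_zero, sub_zero]
    exact (Algebra.commutes c _).symm
  | hx j =>
    rw [(action_gen j).1, expF_X]
    simp only [add_mul, mul_add, smul_mul_assoc, mul_smul_comm, smul_add, G.xx i j, G.xy i j,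
      G.xy j i, G.yy i j]
    module
  | hy j =>
    rw [(action_gen j).2.1, expF_Y]
    simp only [add_mul, mul_add, smul_mul_assoc, mul_smul_comm, G.xy j i, G.yy i j, neg_mul]
    module
  | hadd a b ha hb => rw [mul_add, ha, hb, map_add, map_add, add_mul, add_mul]; module
  | hmul a b ha hb =>
    rw [← mul_assoc, ha, sub_mul, mul_assoc, hb, smul_mul_assoc, mul_assoc, Y_mul i b, map_mul,
      opH_mul, add_mul, mul_sub, mul_smul_comm, mul_assoc, mul_assoc, mul_assoc]
    module

theorem expF_of_opF_eq_zero {a : HAlg h I} (ha : opF h I a = 0) (t : ℂ) : expF h t a = a := by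
  obtain ⟨N, h1, h2⟩ := expF_eq_sum a
  rw [h2]
  -- The bound `N = 0` means `F^0 a = 0`, that is, `a = 0`.
  rcases N with _ | N
  · simpa using (h1 0 le_rfl).symm
  · rw [Finset.sum_range_succ', Finset.sum_eq_zero]
    · simp
    · intro k _
      rw [Function.iterate_succ_apply, ha, iterate_map_zero, smul_zero]

/-! ### Invariants are central and pass through the action. -/

namespace IsInvariant

theorem expF {a : HAlg h I} (ha : IsInvariant a) (t : ℂ) : expF h t a = a :=
  expF_of_opF_eq_zero ha.2.1 t

/-- For invariant `a` the twists in `Y_mul` and `X_add_mul` disappear, so `a` commutes with `y_i`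
and `x_i + (h/2) y_i`, hence with all generators. -/
theorem mem_center {a : HAlg h I} (ha : IsInvariant a) :
    a ∈ Subalgebra.center ℂ (HAlg h I) := by
  have hY : ∀ i, Y h i * a = a * Y h i := fun i => by rw [Y_mul, ha.expF]
  have hX : ∀ i, X h i * a = a * X h i := fun i => by
    have := X_add_mul i a
    rw [ha.expF, ha.2.2, zero_mul, smul_zero, sub_zero, add_mul, mul_add, smul_mul_assoc, hY,
      mul_smul_comm] at this
    exact add_right_cancel this
  rw [Subalgebra.mem_center_iff]
  intro b
  induction b using induct with
  | hc c => exact Algebra.commutes c a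
  | hx i => exact hX i
  | hy i => exact hY i
  | hadd b c hb hc => rw [add_mul, mul_add, hb, hc]
  | hmul b c hb hc => rw [mul_assoc, hc, ← mul_assoc, hb, mul_assoc]

theorem one : IsInvariant (1 : HAlg h I) := ⟨action_one.2.1, action_one.2.2, action_one.1⟩

theorem mul {a b : HAlg h I} (ha : IsInvariant a) (hb : IsInvariant b) : IsInvariant (a * b) := by
  refine ⟨?_, ?_, ?_⟩
  · rw [opE_mul, ha.1, hb.1]; simp
  · rw [opF_mul, ha.2.1, hb.2.1]; simp
  · rw [opH_mul, ha.2.2, hb.2.2]; simp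

theorem pow {a : HAlg h I} (ha : IsInvariant a) (n : ℕ) : IsInvariant (a ^ n) := by
  induction n with
  | zero => rw [pow_zero]; exact one
  | succ n ih => rw [pow_succ]; exact ih.mul ha

theorem smul {a : HAlg h I} (ha : IsInvariant a) (c : ℂ) : IsInvariant (c • a) := by
  simp [IsInvariant, ha.1, ha.2.1, ha.2.2]

theorem opE_mul {a : HAlg h I} (ha : IsInvariant a) (b : HAlg h I) :
    opE h I (a * b) = a * opE h I b := by
  rw [NCForm.opE_mul, ha.1, ha.expF, zero_mul, zero_add]

theorem opF_mul {a : HAlg h I} (ha : IsInvariant a) (b : HAlg h I) :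
    opF h I (a * b) = a * opF h I b := by
  rw [NCForm.opF_mul, ha.2.1, zero_mul, zero_add]

theorem opH_mul {a : HAlg h I} (ha : IsInvariant a) (b : HAlg h I) :
    opH h I (a * b) = a * opH h I b := by
  rw [NCForm.opH_mul, ha.2.2, ha.expF, zero_mul, zero_add]

end IsInvariant

theorem isInvariant_bracket (i j : I) : IsInvariant (bracket h i j) := by
  refine ⟨?_, ?_, ?_⟩
  all_goals
    simp only [bracket, map_sub, map_smul, opE_mul, opF_mul, opH_mul, action_gen, expF_X, expF_Y,
      add_mul, mul_add, smul_mul_assoc, mul_smul_comm, mul_neg, neg_mul, mul_zero, zero_mul]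
    module

theorem bracket_self (i : I) : bracket h i i = 0 := by
  rw [bracket, (good_XY h).xy i i]; module

/-! ### Polarization -/

theorem polD_algebraMap (k l : I) (c : ℂ) : polD h k l (algebraMap ℂ _ c) = 0 := by
  have : polD h k l (1 : HAlg h I) = 0 := by simp [polD, twistDer]
  rw [Algebra.algebraMap_eq_smul_one, map_smul, this, smul_zero]

theorem polD_X (k l i : I) : polD h k l (X h i) = if i = k then X h l else 0 := by simp [polD]

theorem polD_Y (k l i : I) : polD h k l (Y h i) = if i = k then Y h l else 0 := by simp [polD]

/-- `Δ_{kl}` only changes the index and the action treats all indices alike. This case comes before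
those of `E` and `H`, whose Leibniz rules contain `e^{±hF}`. -/
theorem expF_polD (t : ℂ) (k l : I) (a : HAlg h I) :
    expF h t (polD h k l a) = polD h k l (expF h t a) := by
  induction a using induct with
  | hc c => rw [AlgHom.commutes, polD_algebraMap, map_zero]
  | hx i =>
    rw [expF_X, map_add, map_smul, polD_X, polD_Y]
    split_ifs
    · rw [expF_X]
    · simp
  | hy i =>
    rw [expF_Y, polD_Y]
    split_ifs
    · rw [expF_Y]
    · simp
  | hadd a b ha hb => rw [map_add, map_add, ha, hb, map_add, map_add]
  | hmul a b ha hb => rw [polD_mul, map_add, map_mul, map_mul, ha, hb, map_mul, polD_mul]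

theorem opF_polD (k l : I) (a : HAlg h I) :
    opF h I (polD h k l a) = polD h k l (opF h I a) := by
  induction a using induct with
  | hc c => rw [opF_algebraMap, polD_algebraMap, map_zero, map_zero]
  | hx i => rw [(action_gen i).2.2.2.2.1, polD_X, polD_Y]; split_ifs <;> simp [action_gen]
  | hy i => rw [(action_gen i).2.2.2.2.2, polD_Y]; split_ifs <;> simp [action_gen]
  | hadd a b ha hb => rw [map_add, map_add, ha, hb, map_add, map_add]
  | hmul a b ha hb => simp only [polD_mul, map_add, opF_mul, ha, hb]; abel

theorem opE_polD (k l : I) (a : HAlg h I) :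
    opE h I (polD h k l a) = polD h k l (opE h I a) := by
  induction a using induct with
  | hc c => rw [opE_algebraMap, polD_algebraMap, map_zero, map_zero]
  | hx i => rw [(action_gen i).2.2.1, polD_X]; split_ifs <;> simp [action_gen]
  | hy i => rw [(action_gen i).2.2.2.1, polD_X, polD_Y]; split_ifs <;> simp [action_gen]
  | hadd a b ha hb => rw [map_add, map_add, ha, hb, map_add, map_add]
  | hmul a b ha hb => simp only [polD_mul, map_add, opE_mul, ha, hb, expF_polD]; abel

theorem opH_polD (k l : I) (a : HAlg h I) :
    opH h I (polD h k l a) = polD h k l (opH h I a) := by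
  induction a using induct with
  | hc c => rw [opH_algebraMap, polD_algebraMap, map_zero, map_zero]
  | hx i => rw [(action_gen i).1, polD_X]; split_ifs <;> simp [action_gen]
  | hy i => rw [(action_gen i).2.1, map_neg, polD_Y]; split_ifs <;> simp [action_gen]
  | hadd a b ha hb => rw [map_add, map_add, ha, hb, map_add, map_add]
  | hmul a b ha hb => simp only [polD_mul, map_add, opH_mul, ha, hb, expF_polD]; abel

theorem IsInvariant.polD {a : HAlg h I} (ha : IsInvariant a) (k l : I) :
    IsInvariant (polD h k l a) := by
  refine ⟨?_, ?_, ?_⟩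
  · rw [opE_polD, ha.1, map_zero]
  · rw [opF_polD, ha.2.1, map_zero]
  · rw [opH_polD, ha.2.2, map_zero]

/-! ### Homogeneous elements -/

open Polynomial in
theorem degHom_X (k i : I) :
    degHom h k (X h i) = monomial (if i = k then 1 else 0) (X h i) := by simp [degHom]

open Polynomial in
theorem degHom_Y (k i : I) :
    degHom h k (Y h i) = monomial (if i = k then 1 else 0) (Y h i) := by simp [degHom]

/-- Homogeneity of degree `d` with respect to the index `k`. -/
def IsHomog (k : I) (d : ℕ) (a : HAlg h I) : Prop := degHom h k a = Polynomial.monomial d a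

namespace IsHomog

theorem add {k : I} {d : ℕ} {a b : HAlg h I} (ha : IsHomog k d a) (hb : IsHomog k d b) :
    IsHomog k d (a + b) := by
  rw [IsHomog, map_add, ha, hb, map_add]

theorem sub {k : I} {d : ℕ} {a b : HAlg h I} (ha : IsHomog k d a) (hb : IsHomog k d b) :
    IsHomog k d (a - b) := by
  rw [IsHomog, map_sub, ha, hb, map_sub]

theorem smul {k : I} {d : ℕ} {a : HAlg h I} (ha : IsHomog k d a) (c : ℂ) :
    IsHomog k d (c • a) := by
  rw [IsHomog, map_smul, ha, Polynomial.smul_monomial]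

theorem sum {k : I} {d : ℕ} {ι : Type*} {s : Finset ι} {a : ι → HAlg h I}
    (ha : ∀ j ∈ s, IsHomog k d (a j)) : IsHomog k d (∑ j ∈ s, a j) := by
  rw [IsHomog, map_sum, map_sum]
  exact Finset.sum_congr rfl ha

theorem mul {k : I} {d e : ℕ} {a b : HAlg h I} (ha : IsHomog k d a) (hb : IsHomog k e b) :
    IsHomog k (d + e) (a * b) := by
  rw [IsHomog, map_mul, ha, hb, Polynomial.monomial_mul_monomial]

theorem pow {k : I} {d : ℕ} {a : HAlg h I} (ha : IsHomog k d a) (n : ℕ) :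
    IsHomog k (n * d) (a ^ n) := by
  rw [IsHomog, map_pow, ha, Polynomial.monomial_pow, mul_comm]

theorem X_self (k : I) : IsHomog k 1 (X h k) := by rw [IsHomog, degHom_X, if_pos rfl]
theorem Y_self (k : I) : IsHomog k 1 (Y h k) := by rw [IsHomog, degHom_Y, if_pos rfl]
theorem X_of_ne {k i : I} (hi : i ≠ k) : IsHomog k 0 (X h i) := by rw [IsHomog, degHom_X, if_neg hi]
theorem Y_of_ne {k i : I} (hi : i ≠ k) : IsHomog k 0 (Y h i) := by rw [IsHomog, degHom_Y, if_neg hi]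

end IsHomog

theorem without_mono {S T : Set I} (hST : S ⊆ T) : without h T ≤ without h S := by
  apply Algebra.adjoin_mono
  rintro a ⟨i, hi, ha⟩
  exact ⟨i, fun hS => hi (hST hS), ha⟩

theorem X_mem_without {S : Set I} {i : I} (hi : i ∉ S) : X h i ∈ without h S :=
  Algebra.subset_adjoin ⟨i, hi, Or.inl rfl⟩

theorem Y_mem_without {S : Set I} {i : I} (hi : i ∉ S) : Y h i ∈ without h S :=
  Algebra.subset_adjoin ⟨i, hi, Or.inr rfl⟩

@[elab_as_elim]
theorem without_induct {S : Set I} {C : (a : HAlg h I) → a ∈ without h S → Prop} {a : HAlg h I}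
    (ha : a ∈ without h S) (hc : ∀ c : ℂ, C (algebraMap ℂ _ c) (Subalgebra.algebraMap_mem _ c))
    (hx : ∀ i, ∀ hi : i ∉ S, C (X h i) (X_mem_without hi))
    (hy : ∀ i, ∀ hi : i ∉ S, C (Y h i) (Y_mem_without hi))
    (hadd : ∀ a b ha hb, C a ha → C b hb → C (a + b) (add_mem ha hb))
    (hmul : ∀ a b ha hb, C a ha → C b hb → C (a * b) (mul_mem ha hb)) : C a ha := by
  induction ha using Algebra.adjoin_induction with
  | mem a ha =>
    obtain ⟨i, hi, rfl | rfl⟩ := ha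
    · exact hx i hi
    · exact hy i hi
  | algebraMap c => exact hc c
  | add a b _ _ ha hb => exact hadd a b _ _ ha hb
  | mul a b _ _ ha hb => exact hmul a b _ _ ha hb

theorem isHomog_of_mem_without {S : Set I} {k : I} (hk : k ∈ S) {a : HAlg h I}
    (ha : a ∈ without h S) : IsHomog k 0 a := by
  induction ha using without_induct with
  | hc c => rw [IsHomog, AlgHom.commutes]; rfl
  | hx i hi => exact IsHomog.X_of_ne fun e => hi (e ▸ hk)
  | hy i hi => exact IsHomog.Y_of_ne fun e => hi (e ▸ hk)
  | hadd a b _ _ ha hb => exact ha.add hb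
  | hmul a b _ _ ha hb => exact ha.mul hb

-- `Δ_{kl}` lowers the degree in the index `k` by one. The vanishing on degree 0 is proved together
-- with the shift because it removes the boundary terms of the product rule.
open Polynomial in
theorem coeff_degHom_polD {k l : I} (hkl : l ≠ k) (a : HAlg h I) :
    polD h k l ((degHom h k a).coeff 0) = 0 ∧
    ∀ n, (degHom h k (polD h k l a)).coeff n = polD h k l ((degHom h k a).coeff (n + 1)) := by
  induction a using induct with
  | hc c =>
    have e : degHom h k (algebraMap ℂ (HAlg h I) c) = C (algebraMap ℂ _ c) := by
      rw [AlgHom.commutes]; rfl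
    rw [e, polD_algebraMap]
    simp [coeff_C, polD_algebraMap]
  | hx i =>
    rw [degHom_X, polD_X]
    by_cases hi : i = k
    · simp [hi, degHom_X, hkl, coeff_monomial, coeff_C]
      simp [apply_ite (polD h k l), polD_X]
    · simp [hi, polD_X]
  | hy i =>
    rw [degHom_Y, polD_Y]
    by_cases hi : i = k
    · simp [hi, degHom_Y, hkl, coeff_monomial, coeff_C]
      simp [apply_ite (polD h k l), polD_Y]
    · simp [hi, polD_Y]
  | hadd a b ha hb => simp [ha, hb]
  | hmul a b ha hb =>
    refine ⟨by simp [mul_coeff_zero, polD_mul, ha.1, hb.1], fun n => ?_⟩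
    rw [polD_mul, map_add, map_mul, map_mul, coeff_add, coeff_mul, coeff_mul, map_mul, coeff_mul,
      map_sum]
    simp only [polD_mul, Finset.sum_add_distrib]
    -- The pairs of total degree `n + 1` are split off at their degree 0 end, once in each factor;
    -- these end terms vanish by the first half of the hypothesis.
    rw [Finset.Nat.sum_antidiagonal_succ, Finset.Nat.sum_antidiagonal_succ', ha.1, hb.1]
    simp [ha.2, hb.2]

open Polynomial in
theorem IsHomog.polD {k l : I} (hkl : l ≠ k) {d : ℕ} {a : HAlg h I} (ha : IsHomog k (d + 1) a) :
    IsHomog k d (polD h k l a) := by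
  ext n
  rw [(coeff_degHom_polD hkl a).2, ha, coeff_monomial, coeff_monomial]
  by_cases hn : d = n <;> simp [hn]

/-- The degree drops by one at each step, so the divisors `n, n - 1, …` multiply to `n! / (n - m)!`.
-/
theorem polP_iterate {k l : I} (hkl : l ≠ k) {n : ℕ} {a : HAlg h I} (ha : IsHomog k n a) {m : ℕ}
    (hm : m ≤ n) : IsHomog k (n - m) ((polD h k l)^[m] a) ∧
      (polP h k l)^[m] a = (((n - m).factorial : ℂ) / n.factorial) • (polD h k l)^[m] a := by
  induction m with
  | zero =>
    have : (n.factorial : ℂ) ≠ 0 := by exact_mod_cast n.factorial_ne_zero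
    simpa [this] using ha
  | succ m ih =>
    obtain ⟨h1, h2⟩ := ih (by omega)
    obtain ⟨r, hr⟩ : ∃ r, n - m = r + 1 := ⟨n - m - 1, by omega⟩
    rw [hr] at h1 h2
    have hr' : n - (m + 1) = r := by omega
    rw [Function.iterate_succ_apply', Function.iterate_succ_apply', h2, hr', map_smul,
      polP_of_homog k l _ _ h1, smul_smul]
    refine ⟨h1.polD hkl, ?_⟩
    congr 1
    have : (r + 1 : ℂ) ≠ 0 := by exact_mod_cast r.succ_ne_zero
    rw [Nat.factorial_succ]
    push_cast
    field_simp

/-! ### Changes of the index set -/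

variable (h) in
/-- The endomorphism of `H_I` with `x_i ↦ x_{σ i}`, `y_i ↦ y_{σ i}`. -/
noncomputable def reindex (σ : I → I) : HAlg h I →ₐ[ℂ] HAlg h I :=
  lift (fun i => X h (σ i)) (fun i => Y h (σ i))
    ⟨fun i j => (good_XY h).yy (σ i) (σ j), fun i j => (good_XY h).xy (σ i) (σ j),
      fun i j => (good_XY h).xx (σ i) (σ j)⟩

@[simp] theorem reindex_X (σ : I → I) (i : I) : reindex h σ (X h i) = X h (σ i) := by
  simp [reindex]

@[simp] theorem reindex_Y (σ : I → I) (i : I) : reindex h σ (Y h i) = Y h (σ i) := by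
  simp [reindex]

theorem reindex_bracket (σ : I → I) (i j : I) :
    reindex h σ (bracket h i j) = bracket h (σ i) (σ j) := by
  simp [bracket]

theorem reindex_of_mem_without {σ : I → I} {S : Set I} (hσ : ∀ i ∉ S, σ i = i) {a : HAlg h I}
    (ha : a ∈ without h S) : reindex h σ a = a := by
  induction ha using without_induct with
  | hc c => exact AlgHom.commutes _ c
  | hx i hi => rw [reindex_X, hσ i hi]
  | hy i hi => rw [reindex_Y, hσ i hi]
  | hadd a b _ _ ha hb => rw [map_add, ha, hb]
  | hmul a b _ _ ha hb => rw [map_mul, ha, hb]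

theorem reindex_injective (σ : Equiv.Perm I) : Function.Injective (reindex h σ) := by
  have : (reindex h σ.symm).comp (reindex h σ) = AlgHom.id ℂ _ := hom_ext (by simp) (by simp)
  intro a b hab
  have := congrArg (reindex h σ.symm) hab
  rwa [← AlgHom.comp_apply, ← AlgHom.comp_apply, ‹(reindex h σ.symm).comp _ = _›] at this

theorem X_ne_zero (i : I) : X h i ≠ 0 := by
  intro h0
  have := (rep_gen h (Gen.x i)).2
  simp only [gen, h0, map_zero, Polynomial.coeff_zero] at this
  have := LinearMap.congr_fun this 1
  simp [sym] at this

theorem bracket_ne_zero {i j : I} (hij : i ≠ j) : bracket h i j ≠ 0 := by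
  intro h0
  -- In the differential operator representation the leading coefficient of `(ij)`, applied to 1, is
  -- `y_i y_j (x_i - x_j)`. It is nonzero at the point where `x_i` is 1, the other `x` are 0 and all
  -- `y` are 1.
  have := congrArg (fun p => Polynomial.coeff (rep h I p) 1 1) h0
  simp [bracket, rep] at this
  have := congrArg (MvPolynomial.eval fun g => match g with
    | Gen.x k => if k = i then (1 : ℂ) else 0
    | Gen.y _ => 1) this
  simp [hij.symm] at this

/-! ### Taylor expansion along a polarization. -/

open Polynomial in
variable (h) in
/-- The homomorphism `e^{TΔ}` for `Δ = Δ_{kl}`, with a formal parameter `T`. -/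
noncomputable def polT (k l : I) : HAlg h I →ₐ[ℂ] (HAlg h I)[X] :=
  lift (fun i => monomial 0 (X h i) + if i = k then monomial 1 (X h l) else 0)
    (fun i => monomial 0 (Y h i) + if i = k then monomial 1 (Y h l) else 0) (by
    have G := good_XY h (I := I)
    have e : ∀ (i : I) (z : HAlg h I), (if i = k then monomial 1 z else 0) =
      (if i = k then (1 : ℂ) else 0) • monomial 1 z := fun i z => by split_ifs <;> simp
    simp only [e]
    refine ⟨fun i j => ?_, fun i j => ?_, fun i j => ?_⟩ <;>
      generalize (if i = k then (1 : ℂ) else 0) = u <;>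
      generalize (if j = k then (1 : ℂ) else 0) = v <;>
      simp only [monomial_mul_monomial, add_mul, mul_add, smul_add, smul_mul_assoc, mul_smul_comm,
        add_zero, zero_add, G.xx i j, G.xy i j, G.yy i j, G.xx i l, G.xy i l, G.yy i l, G.xx l j,
        G.xy l j, G.yy l j, G.xy l l, map_add, map_sub, ← smul_monomial, smul_sub] <;>
      module)

open Polynomial in
theorem polT_of_mem_without {k l : I} {S : Set I} (hk : k ∈ S) {a : HAlg h I}
    (ha : a ∈ without h S) : polT h k l a = C a := by
  induction ha using without_induct with
  | hc c => rw [AlgHom.commutes]; rfl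
  | hx i hi =>
    have : i ≠ k := fun e => hi (e ▸ hk)
    simp [polT, this]
  | hy i hi =>
    have : i ≠ k := fun e => hi (e ▸ hk)
    simp [polT, this]
  | hadd a b _ _ ha hb => rw [map_add, ha, hb, map_add]
  | hmul a b _ _ ha hb => rw [map_mul, ha, hb, map_mul]

-- Since `l ≠ k`, `Δ_{kl}` kills `x_l` and `y_l`; hence the exponential series of a generator stops
-- after its linear term, as in the definition of `polT`.
open Polynomial in
theorem derivative_polT {k l : I} (hkl : l ≠ k) (a : HAlg h I) :
    derivative (polT h k l a) = polT h k l (polD h k l a) := by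
  induction a using induct with
  | hc c =>
    rw [polD_algebraMap, map_zero, AlgHom.commutes]
    exact derivative_C
  | hx i =>
    rw [polD_X]
    by_cases hi : i = k <;> simp [polT, hi, hkl]
  | hy i =>
    rw [polD_Y]
    by_cases hi : i = k <;> simp [polT, hi, hkl]
  | hadd a b ha hb => simp [ha, hb]
  | hmul a b ha hb => simp [derivative_mul, ha, hb, polD_mul]

theorem polD_iterate_eq {k l : I} (hkl : l ≠ k) (m : ℕ) (a : HAlg h I) :
    (polD h k l)^[m] a = (m.factorial : ℂ) • (polT h k l a).coeff m := by
  induction m generalizing a with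
  | zero =>
    have e : ∀ a, (polT h k l a).coeff 0 = a := by
      intro a
      induction a using induct with
      | hc c => rw [AlgHom.commutes]; exact Polynomial.coeff_C_zero
      | hx i => by_cases hi : i = k <;> simp [polT, hi]
      | hy i => by_cases hi : i = k <;> simp [polT, hi]
      | hadd a b ha hb => simp [ha, hb]
      | hmul a b ha hb => rw [map_mul, Polynomial.mul_coeff_zero, ha, hb]
    simp [e]
  | succ m ih =>
    rw [Function.iterate_succ_apply, ih, ← derivative_polT hkl, Polynomial.coeff_derivative,
      Nat.factorial_succ, Nat.cast_mul, mul_comm, mul_smul, ← Nat.cast_succ, ← nsmul_eq_mul',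
      Nat.cast_smul_eq_nsmul ℂ (m + 1)]

/-! ### Expansion of products -/

/-- The coefficient of `s ^ j` in the product of `a + s b` over the pairs `(a, b)` in a list. -/
def expandCoeff {R : Type*} [Ring R] : List (R × R) → ℕ → R
  | [], 0 => 1
  | [], _ + 1 => 0
  | (a, _) :: l, 0 => a * expandCoeff l 0
  | (a, b) :: l, j + 1 => a * expandCoeff l (j + 1) + b * expandCoeff l j

theorem expandCoeff_of_lt {R : Type*} [Ring R] (l : List (R × R)) (j : ℕ) (hj : l.length < j) :
    expandCoeff l j = 0 := by
  induction l generalizing j with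
  | nil => obtain _ | j := j <;> simp_all [expandCoeff]
  | cons p l ih =>
    obtain _ | j := j
    · simp at hj
    · simp only [List.length_cons] at hj
      simp [expandCoeff, ih _ (show l.length < j + 1 by omega), ih _ (show l.length < j by omega)]

theorem map_expandCoeff {R R' : Type*} [Ring R] [Ring R'] (φ : R →+* R') (l : List (R × R))
    (j : ℕ) : φ (expandCoeff l j) = expandCoeff (l.map (Prod.map φ φ)) j := by
  induction l generalizing j with
  | nil => obtain _ | j := j <;> simp [expandCoeff]
  | cons p l ih => obtain _ | j := j <;> simp [expandCoeff, ih]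

/-- Only the parameters `s`, `t` have to be central: they are collected on the left while the
letters `a`, `b` keep their order. -/
theorem prod_eq_sum_expandCoeff {R : Type*} [Ring R] {s t : R} (hs : ∀ a, Commute s a)
    (ht : ∀ a, Commute t a) (l : List (R × R)) :
    (l.map fun p => s * p.1 + t * p.2).prod =
      ∑ p ∈ Finset.HasAntidiagonal.antidiagonal l.length, s ^ p.1 * t ^ p.2 * expandCoeff l p.2 := by
  induction l with
  | nil => simp [expandCoeff]
  | cons p l ih =>
    obtain ⟨a, b⟩ := p
    have e : ∀ i j : ℕ, ∀ c : R, s ^ (i + 1) * t ^ j * (a * c) = s * a * (s ^ i * t ^ j * c) := by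
      intro i j c
      rw [pow_succ', mul_assoc s (_ ^ _), mul_assoc s, mul_assoc s,
        ← mul_assoc a, (((hs a).pow_left i).mul_left ((ht a).pow_left j)).symm.eq]
      simp only [mul_assoc]
    have e' : ∀ i j : ℕ, ∀ c : R, s ^ i * t ^ (j + 1) * (b * c) = t * b * (s ^ i * t ^ j * c) := by
      intro i j c
      rw [pow_succ', ← mul_assoc (s ^ i), ← ((ht (s ^ i))).eq, mul_assoc t (_ ^ _), mul_assoc t,
        mul_assoc t, ← mul_assoc b, (((hs b).pow_left i).mul_left ((ht b).pow_left j)).symm.eq]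
      simp only [mul_assoc]
    rw [List.map_cons, List.prod_cons, ih, List.length_cons, add_mul, Finset.mul_sum,
      Finset.mul_sum]
    have h1 : ∑ p ∈ Finset.HasAntidiagonal.antidiagonal (l.length + 1), s ^ p.1 * t ^ p.2 *
          (a * expandCoeff l p.2) =
        ∑ p ∈ Finset.HasAntidiagonal.antidiagonal l.length, s * a * (s ^ p.1 * t ^ p.2 * expandCoeff l p.2) := by
      -- The extra term, with exponent `l.length + 1` of `t`, vanishes because the list has too few
      -- factors.
      rw [Finset.Nat.sum_antidiagonal_succ, expandCoeff_of_lt l _ (Nat.lt_succ_self _)]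
      simp [e]
    have h2 : ∀ p : ℕ × ℕ, s ^ p.1 * t ^ p.2 * expandCoeff ((a, b) :: l) p.2 =
        s ^ p.1 * t ^ p.2 * (a * expandCoeff l p.2) + s ^ p.1 * t ^ p.2 *
          (match p.2 with
            | 0 => 0
            | j + 1 => b * expandCoeff l j) := by
      rintro ⟨i, _ | j⟩
      · simp [expandCoeff]
      · simp [expandCoeff, mul_add]
    simp only [h2, Finset.sum_add_distrib, h1]
    congr 1
    rw [Finset.Nat.sum_antidiagonal_succ']
    simp [e']

/-- The pairs `(a, b)`, `n - k` times, and `(c, d)`, `k` times. -/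
def pairList {R : Type*} (n k : ℕ) (a b c d : R) : List (R × R) :=
  List.replicate (n - k) (a, b) ++ List.replicate k (c, d)

theorem pow_mul_pow_eq_sum {R : Type*} [Ring R] {s t : R} (hs : ∀ a, Commute s a)
    (ht : ∀ a, Commute t a) {n k : ℕ} (hk : k ≤ n) (a b c d : R) :
    (s * a + t * b) ^ (n - k) * (s * c + t * d) ^ k =
      ∑ p ∈ Finset.HasAntidiagonal.antidiagonal n, s ^ p.1 * t ^ p.2 * expandCoeff (pairList n k a b c d) p.2 := by
  have := prod_eq_sum_expandCoeff hs ht (pairList n k a b c d)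
  rw [show (pairList n k a b c d).length = n by simp [pairList]; omega] at this
  rw [← this]
  simp [pairList]

theorem map_expandCoeff_pairList {R R' : Type*} [Ring R] [Ring R'] (φ : R →+* R') (n k : ℕ)
    (a b c d : R) (j : ℕ) : φ (expandCoeff (pairList n k a b c d) j) =
      expandCoeff (pairList n k (φ a) (φ b) (φ c) (φ d)) j := by
  rw [map_expandCoeff]; simp [pairList]

/-! ### Normal form of homogeneous elements -/

variable (h) in
/-- The span of the products `x_i ^ a * y_i ^ b * c` with `a ≤ N`, `a + b = d`, where `c` does not
involve the index `i`. -/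
noncomputable def normalSpan (i : I) (N d : ℕ) : Submodule ℂ (HAlg h I) :=
  Submodule.span ℂ {z | ∃ a b c, c ∈ without h {i} ∧ a ≤ N ∧ a + b = d ∧
    z = X h i ^ a * Y h i ^ b * c}

theorem X_mul_mem_normalSpan {i : I} {N d : ℕ} {z : HAlg h I} (hz : z ∈ normalSpan h i N d) :
    X h i * z ∈ normalSpan h i (N + 1) (d + 1) := by
  induction hz using Submodule.span_induction with
  | mem z hz =>
    obtain ⟨a, b, c, hc, ha, hab, rfl⟩ := hz
    exact Submodule.subset_span ⟨a + 1, b, c, hc, by omega, by omega, by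
      simp only [pow_succ', mul_assoc]⟩
  | zero => simp
  | add z w _ _ hz hw => rw [mul_add]; exact add_mem hz hw
  | smul r z _ hz => rw [mul_smul_comm]; exact Submodule.smul_mem _ _ hz

/-- By `y x = x y - h y y`, moving `y_i` to the right past `x_i` creates a term with one `x_i`
fewer. The bound `N` on the exponent of `x_i` is the induction parameter that makes this terminate.
-/
theorem Y_mul_mem_normalSpan {i : I} {N d : ℕ} {z : HAlg h I} (hz : z ∈ normalSpan h i N d) :
    Y h i * z ∈ normalSpan h i N (d + 1) := by
  induction N generalizing d z with
  | zero =>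
    induction hz using Submodule.span_induction with
    | mem z hz =>
      obtain ⟨a, b, c, hc, ha, hab, rfl⟩ := hz
      obtain rfl : a = 0 := by omega
      exact Submodule.subset_span ⟨0, b + 1, c, hc, by omega, by omega, by
        simp only [pow_succ', pow_zero, one_mul, mul_assoc]⟩
    | zero => simp
    | add z w _ _ hz hw => rw [mul_add]; exact add_mem hz hw
    | smul r z _ hz => rw [mul_smul_comm]; exact Submodule.smul_mem _ _ hz
  | succ N ih =>
    have mono : ∀ d, normalSpan h i N d ≤ normalSpan h i (N + 1) d := fun d =>
      Submodule.span_mono fun z ⟨a, b, c, hc, ha, hz⟩ => ⟨a, b, c, hc, by omega, hz⟩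
    induction hz using Submodule.span_induction with
    | mem z hz =>
      obtain ⟨a, b, c, hc, ha, hab, rfl⟩ := hz
      obtain _ | a := a
      · exact Submodule.subset_span ⟨0, b + 1, c, hc, by omega, by omega, by
          simp only [pow_succ', pow_zero, one_mul, mul_assoc]⟩
      · have hw : X h i ^ a * Y h i ^ b * c ∈ normalSpan h i N (a + b) :=
          Submodule.subset_span ⟨a, b, c, hc, by omega, rfl, rfl⟩
        have e : Y h i * (X h i ^ (a + 1) * Y h i ^ b * c) =
            X h i * (Y h i * (X h i ^ a * Y h i ^ b * c)) -
              h • (Y h i * (Y h i * (X h i ^ a * Y h i ^ b * c))) := by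
          have := congrArg (· * (X h i ^ a * Y h i ^ b * c)) ((good_XY h).xy i i)
          simp only [add_mul, smul_mul_assoc, mul_assoc] at this
          rw [pow_succ']
          simp only [mul_assoc]
          rw [this]
          abel
        rw [e]
        have h1 := ih hw
        obtain rfl : d = a + b + 1 := by omega
        -- The induction hypothesis is used twice: one `y_i` in front of `w` leaves the bound at
        -- `N`, so a second one may follow.
        exact sub_mem (X_mul_mem_normalSpan h1) (Submodule.smul_mem _ _ (mono _ (ih h1)))
    | zero => simp
    | add z w _ _ hz hw => rw [mul_add]; exact add_mem hz hw
    | smul r z _ hz => rw [mul_smul_comm]; exact Submodule.smul_mem _ _ hz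

theorem exists_of_mem_normalSpan {i : I} {N d : ℕ} {z : HAlg h I} (hz : z ∈ normalSpan h i N d) :
    ∃ B : Fin (d + 1) → HAlg h I, (∀ k, B k ∈ without h {i}) ∧
      z = ∑ k : Fin (d + 1), X h i ^ (d - (k : ℕ)) * Y h i ^ (k : ℕ) * B k := by
  induction hz using Submodule.span_induction with
  | mem z hz =>
    obtain ⟨a, b, c, hc, ha, hab, rfl⟩ := hz
    let k₀ : Fin (d + 1) := ⟨b, by omega⟩
    refine ⟨Pi.single k₀ c, fun k => ?_, ?_⟩
    · by_cases hk : k = k₀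
      · subst hk; simpa using hc
      · simp [hk]
    · rw [Finset.sum_eq_single k₀]
      · simp [k₀, ← hab]
      · intro k _ hk; simp [hk]
      · simp
  | zero => exact ⟨0, fun k => zero_mem _, by simp⟩
  | add z w _ _ hz hw =>
    obtain ⟨B, hB, rfl⟩ := hz
    obtain ⟨B', hB', rfl⟩ := hw
    exact ⟨B + B', fun k => add_mem (hB k) (hB' k), by simp [mul_add, Finset.sum_add_distrib]⟩
  | smul r z _ hz =>
    obtain ⟨B, hB, rfl⟩ := hz
    exact ⟨r • B, fun k => Subalgebra.smul_mem _ (hB k) _, by simp [Finset.smul_sum]⟩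

variable (h) in
/-- The span of the products `v_1 ⋯ v_d * c` where each `v` is `x_i` or `y_i` and `c` does not involve
the index `i`. -/
noncomputable def homogSpan (i : I) : ℕ → Submodule ℂ (HAlg h I)
  | 0 => Subalgebra.toSubmodule (without h {i})
  | d + 1 => (homogSpan i d).map (LinearMap.mulLeft ℂ (X h i)) ⊔
      (homogSpan i d).map (LinearMap.mulLeft ℂ (Y h i))

theorem X_mul_mem_homogSpan {i : I} {d : ℕ} {z : HAlg h I} (hz : z ∈ homogSpan h i d) :
    X h i * z ∈ homogSpan h i (d + 1) :=
  Submodule.mem_sup_left ⟨z, hz, rfl⟩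

theorem Y_mul_mem_homogSpan {i : I} {d : ℕ} {z : HAlg h I} (hz : z ∈ homogSpan h i d) :
    Y h i * z ∈ homogSpan h i (d + 1) :=
  Submodule.mem_sup_right ⟨z, hz, rfl⟩

theorem homogSpan_le_normalSpan (i : I) (d : ℕ) : homogSpan h i d ≤ normalSpan h i d d := by
  induction d with
  | zero => exact fun z hz => Submodule.subset_span ⟨0, 0, z, hz, le_rfl, rfl, by simp⟩
  | succ d ih =>
    refine sup_le (Submodule.map_le_iff_le_comap.2 fun z hz => ?_)
      (Submodule.map_le_iff_le_comap.2 fun z hz => ?_)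
    · exact X_mul_mem_normalSpan (ih hz)
    · have := Y_mul_mem_normalSpan (ih hz)
      refine Submodule.span_mono ?_ this
      rintro z ⟨a, b, c, hc, ha, hz⟩
      exact ⟨a, b, c, hc, by omega, hz⟩

/-- The relations carry a letter with index `j` past a letter with index `i`, leaving the index `i`
on the left and the number of its letters unchanged. -/
theorem mul_mem_homogSpan_of_ne {i j : I} (hj : j ≠ i) {d : ℕ} {z : HAlg h I}
    (hz : z ∈ homogSpan h i d) :
    X h j * z ∈ homogSpan h i d ∧ Y h j * z ∈ homogSpan h i d := by
  have G := good_XY h (I := I)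
  induction d generalizing z with
  | zero =>
    exact ⟨(without h {i}).mul_mem (X_mem_without (by simpa using hj)) hz,
      (without h {i}).mul_mem (Y_mem_without (by simpa using hj)) hz⟩
  | succ d ih =>
    obtain ⟨_, ⟨u, hu, rfl⟩, _, ⟨v, hv, rfl⟩, rfl⟩ := Submodule.mem_sup.1 hz
    simp only [LinearMap.mulLeft_apply]
    have hu' := ih hu
    have hv' := ih hv
    constructor
    · have e : X h j * (X h i * u + Y h i * v) = X h i * (X h j * u - h • (Y h j * u)) +
          Y h i * (h • (X h j * u) + h ^ 2 • (Y h j * u) + (X h j * v + h • (Y h j * v))) := by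
        rw [mul_add, ← mul_assoc, ← mul_assoc, G.xx i j, G.xy i j]
        simp only [add_mul, sub_mul, mul_add, mul_sub, smul_mul_assoc, mul_smul_comm, mul_assoc]
        module
      rw [e]
      exact add_mem (X_mul_mem_homogSpan (sub_mem hu'.1 (Submodule.smul_mem _ _ hu'.2)))
        (Y_mul_mem_homogSpan (add_mem (add_mem (Submodule.smul_mem _ _ hu'.1)
          (Submodule.smul_mem _ _ hu'.2)) (add_mem hv'.1 (Submodule.smul_mem _ _ hv'.2))))
    · have e : Y h j * (X h i * u + Y h i * v) = X h i * (Y h j * u) +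
          Y h i * (Y h j * v - h • (Y h j * u)) := by
        rw [mul_add, ← mul_assoc, ← mul_assoc, ← mul_assoc, G.xy j i, G.yy i j]
        simp only [add_mul, mul_sub, smul_mul_assoc, mul_smul_comm, ← mul_assoc]
        module
      rw [e]
      exact add_mem (X_mul_mem_homogSpan hu'.2)
        (Y_mul_mem_homogSpan (sub_mem hv'.2 (Submodule.smul_mem _ _ hu'.2)))

/-- Left multiplication by an arbitrary element, rather than membership of that element, is what can
be proved by induction over products; applied to `z = 1` it gives the normal form. -/
theorem coeff_degHom_mul_mem_homogSpan (i : I) (a : HAlg h I) (d e : ℕ) {z : HAlg h I}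
    (hz : z ∈ homogSpan h i e) : (degHom h i a).coeff d * z ∈ homogSpan h i (d + e) := by
  induction a using induct generalizing d e z with
  | hc c =>
    have e : degHom h i (algebraMap ℂ (HAlg h I) c) = Polynomial.C (algebraMap ℂ _ c) := by
      rw [AlgHom.commutes]; rfl
    rw [e, Polynomial.coeff_C]
    split_ifs with hd
    · subst hd
      rw [zero_add, ← Algebra.smul_def]
      exact Submodule.smul_mem _ _ hz
    · simp
  | hx j =>
    rw [degHom_X, Polynomial.coeff_monomial]
    split_ifs with h1 h2 h2
    · subst h1 h2; rw [add_comm]; exact X_mul_mem_homogSpan hz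
    · simp
    · subst h2; rw [zero_add]; exact (mul_mem_homogSpan_of_ne h1 hz).1
    · simp
  | hy j =>
    rw [degHom_Y, Polynomial.coeff_monomial]
    split_ifs with h1 h2 h2
    · subst h1 h2; rw [add_comm]; exact Y_mul_mem_homogSpan hz
    · simp
    · subst h2; rw [zero_add]; exact (mul_mem_homogSpan_of_ne h1 hz).2
    · simp
  | hadd a b ha hb =>
    rw [map_add, Polynomial.coeff_add, add_mul]
    exact add_mem (ha d e hz) (hb d e hz)
  | hmul a b ha hb =>
    rw [map_mul, Polynomial.coeff_mul, Finset.sum_mul]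
    refine sum_mem fun p hp => ?_
    rw [← Finset.HasAntidiagonal.mem_antidiagonal.1 hp, mul_assoc, add_assoc]
    exact ha _ _ (hb _ _ hz)

theorem IsHomog.exists_eq_sum {i : I} {d : ℕ} {a : HAlg h I} (ha : IsHomog i d a) :
    ∃ B : Fin (d + 1) → HAlg h I, (∀ k, B k ∈ without h {i}) ∧
      a = ∑ k : Fin (d + 1), X h i ^ (d - (k : ℕ)) * Y h i ^ (k : ℕ) * B k := by
  have h1 := coeff_degHom_mul_mem_homogSpan i a d 0 (z := 1) (one_mem (without h {i}))
  rw [ha, Polynomial.coeff_monomial_same, mul_one] at h1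
  exact exists_of_mem_normalSpan (homogSpan_le_normalSpan i d h1)

/-- The normal form supplies the coefficients up to the binomial factors, which are invertible in
`ℂ`. -/
theorem IsHomog.isForm {i : I} {d : ℕ} {a : HAlg h I} (ha : IsHomog i d a) (h0 : a ≠ 0)
    (hinv : IsInvariant a) : IsForm i d a := by
  obtain ⟨B, hB, e⟩ := ha.exists_eq_sum
  refine ⟨h0, hinv, fun k => (d.choose k : ℂ)⁻¹ • B k, fun k => Subalgebra.smul_mem _ (hB k) _, ?_⟩
  conv_lhs => rw [e]
  refine Finset.sum_congr rfl fun k _ => ?_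
  have : (d.choose k : ℂ) ≠ 0 := by
    exact_mod_cast (Nat.choose_pos (Nat.lt_succ_iff.1 k.2)).ne'
  rw [mul_smul_comm, smul_inv_smul₀ this]

/-! ### Operators preserve subalgebras -/

theorem expF_mem_without {S : Set I} (t : ℂ) {a : HAlg h I} (ha : a ∈ without h S) :
    expF h t a ∈ without h S := by
  induction ha using without_induct with
  | hc c => rw [AlgHom.commutes]; exact Subalgebra.algebraMap_mem _ c
  | hx i hi =>
    rw [expF_X]
    exact add_mem (X_mem_without hi) (Subalgebra.smul_mem _ (Y_mem_without hi) _)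
  | hy i hi => rw [expF_Y]; exact Y_mem_without hi
  | hadd a b _ _ ha hb => rw [map_add]; exact add_mem ha hb
  | hmul a b _ _ ha hb => rw [map_mul]; exact mul_mem ha hb

theorem opF_mem_without {S : Set I} {a : HAlg h I} (ha : a ∈ without h S) :
    opF h I a ∈ without h S := by
  induction ha using without_induct with
  | hc c => rw [opF_algebraMap]; exact zero_mem _
  | hx i hi => rw [(action_gen i).2.2.2.2.1]; exact Y_mem_without hi
  | hy i hi => rw [(action_gen i).2.2.2.2.2]; exact zero_mem _
  | hadd a b _ _ ha hb => rw [map_add]; exact add_mem ha hb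
  | hmul a b ha hb ha' hb' => rw [opF_mul]; exact add_mem (mul_mem ha' hb) (mul_mem ha hb')

theorem opE_mem_without {S : Set I} {a : HAlg h I} (ha : a ∈ without h S) :
    opE h I a ∈ without h S := by
  induction ha using without_induct with
  | hc c => rw [opE_algebraMap]; exact zero_mem _
  | hx i hi => rw [(action_gen i).2.2.1]; exact zero_mem _
  | hy i hi => rw [(action_gen i).2.2.2.1]; exact X_mem_without hi
  | hadd a b _ _ ha hb => rw [map_add]; exact add_mem ha hb
  | hmul a b ha hb ha' hb' =>
    rw [opE_mul]
    exact add_mem (mul_mem ha' (expF_mem_without _ hb)) (mul_mem (expF_mem_without _ ha) hb')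

theorem opH_mem_without {S : Set I} {a : HAlg h I} (ha : a ∈ without h S) :
    opH h I a ∈ without h S := by
  induction ha using without_induct with
  | hc c => rw [opH_algebraMap]; exact zero_mem _
  | hx i hi => rw [(action_gen i).1]; exact X_mem_without hi
  | hy i hi => rw [(action_gen i).2.1]; exact neg_mem (Y_mem_without hi)
  | hadd a b _ _ ha hb => rw [map_add]; exact add_mem ha hb
  | hmul a b ha hb ha' hb' =>
    rw [opH_mul]
    exact add_mem (mul_mem ha' (expF_mem_without _ hb)) (mul_mem (expF_mem_without _ ha) hb')

theorem coeff_degHom_mem_without {S : Set I} (k : I) {a : HAlg h I} (ha : a ∈ without h S) (d : ℕ) :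
    (degHom h k a).coeff d ∈ without h S := by
  induction ha using without_induct generalizing d with
  | hc c =>
    have e : degHom h k (algebraMap ℂ (HAlg h I) c) = Polynomial.C (algebraMap ℂ _ c) := by
      rw [AlgHom.commutes]; rfl
    rw [e, Polynomial.coeff_C]
    split_ifs
    exacts [Subalgebra.algebraMap_mem _ c, zero_mem _]
  | hx i hi =>
    rw [degHom_X, Polynomial.coeff_monomial]
    split_ifs
    exacts [X_mem_without hi, zero_mem _, X_mem_without hi, zero_mem _]
  | hy i hi =>
    rw [degHom_Y, Polynomial.coeff_monomial]
    split_ifs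
    exacts [Y_mem_without hi, zero_mem _, Y_mem_without hi, zero_mem _]
  | hadd a b _ _ ha hb => rw [map_add, Polynomial.coeff_add]; exact add_mem (ha d) (hb d)
  | hmul a b _ _ ha hb =>
    rw [map_mul, Polynomial.coeff_mul]
    exact sum_mem fun p _ => mul_mem (ha _) (hb _)

theorem degHom_eval_one (k : I) (a : HAlg h I) : (degHom h k a).eval 1 = a := by
  induction a using induct with
  | hc c => rw [AlgHom.commutes]; exact Polynomial.eval_C
  | hx i => simp [degHom_X, Polynomial.eval_monomial]
  | hy i => simp [degHom_Y, Polynomial.eval_monomial]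
  | hadd a b ha hb => rw [map_add, Polynomial.eval_add, ha, hb]
  | hmul a b ha hb =>
    rw [map_mul, Polynomial.eval, Polynomial.eval₂_mul_noncomm, ← Polynomial.eval,
      ← Polynomial.eval, ha, hb]
    exact fun _ => Commute.one_right _

/-! ### The linear factors of a typical representation -/

variable (h) in
/-- The pair `x_i, y_i`. -/
noncomputable def vars (i : I) : Fin 2 → HAlg h I := ![X h i, Y h i]

variable (h) in
/-- Evaluation of noncommutative polynomials in two variables at `x_i, y_i`. -/
noncomputable def evalVars (i : I) : FreeAlgebra ℂ (Fin 2) →ₐ[ℂ] HAlg h I :=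
  FreeAlgebra.lift ℂ (vars h i)

theorem evalVars_ι (i : I) (b : Fin 2) : evalVars h i (FreeAlgebra.ι ℂ b) = vars h i b := by
  simp [evalVars]

/-- A polynomial in `x_j, y_j` can be moved past `x_i, y_i` with coefficients that do not depend on
the index `i`. -/
theorem exists_evalVars_mul_vars (h : ℂ) (w : FreeAlgebra ℂ (Fin 2)) :
    ∃ N : Fin 2 → Fin 2 → FreeAlgebra ℂ (Fin 2), ∀ (I : Type u) [LinearOrder I] (i j : I) (b : Fin 2),
      evalVars h j w * vars h i b = ∑ c, vars h i c * evalVars h j (N b c) := by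
  induction w using FreeAlgebra.induction with
  | grade0 r =>
    refine ⟨fun b c => if b = c then algebraMap ℂ _ r else 0, fun I _ i j b => ?_⟩
    rw [AlgHom.commutes, Finset.sum_eq_single b]
    · simp [Algebra.commutes]
    · intro c _ hc; simp [hc.symm]
    · simp
  | grade1 a =>
    let x : FreeAlgebra ℂ (Fin 2) := FreeAlgebra.ι ℂ 0
    let y : FreeAlgebra ℂ (Fin 2) := FreeAlgebra.ι ℂ 1
    have hx : ∀ (I : Type u) [LinearOrder I] (j : I), evalVars h j x = X h j := by
      intros; simp [x, evalVars_ι, vars]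
    have hy : ∀ (I : Type u) [LinearOrder I] (j : I), evalVars h j y = Y h j := by
      intros; simp [y, evalVars_ι, vars]
    fin_cases a
    -- Row `b`, column `c` is the right coefficient of the `c`-th letter of `v_i` after `x_j` has
    -- passed the `b`-th one, read off from the `xx` and `xy` relations.
    · refine ⟨![![x - h • y, h • x + h ^ 2 • y], ![0, x + h • y]], fun I _ i j b => ?_⟩
      have G := good_XY h (I := I)
      change evalVars h j x * _ = _
      fin_cases b
      · simp only [Fin.sum_univ_two, vars, hx, Fin.zero_eta, Matrix.cons_val_zero,
          Matrix.cons_val_one, map_add, map_sub, map_smul, hy, mul_add, mul_sub, mul_smul_comm,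
          G.xx i j]
        module
      · simp only [Fin.sum_univ_two, vars, hx, Fin.mk_one, Matrix.cons_val_zero,
          Matrix.cons_val_one, map_add, map_smul, hy, mul_add, mul_smul_comm,
          G.xy i j, map_zero, mul_zero, zero_add]
    · refine ⟨![![y, -(h • y)], ![0, y]], fun I _ i j b => ?_⟩
      have G := good_XY h (I := I)
      change evalVars h j y * _ = _
      fin_cases b
      · simp only [Fin.sum_univ_two, vars, hy, Fin.zero_eta, Matrix.cons_val_zero,
          Matrix.cons_val_one, map_neg, map_smul, mul_neg, mul_smul_comm, G.xy j i, G.yy i j]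
        module
      · simp only [Fin.sum_univ_two, vars, hy, Fin.mk_one, Matrix.cons_val_zero,
          Matrix.cons_val_one, G.yy i j, map_zero, mul_zero, zero_add]
  | mul v w hv hw =>
    obtain ⟨M, hM⟩ := hv
    obtain ⟨N, hN⟩ := hw
    refine ⟨fun b c => ∑ d, M d c * N b d, fun I _ i j b => ?_⟩
    rw [map_mul, mul_assoc, hN, Finset.mul_sum]
    simp only [← mul_assoc, hM, Finset.sum_mul, map_sum, map_mul, Finset.mul_sum]
    rw [Finset.sum_comm]
  | add v w hv hw =>
    obtain ⟨M, hM⟩ := hv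
    obtain ⟨N, hN⟩ := hw
    refine ⟨fun b c => M b c + N b c, fun I _ i j b => ?_⟩
    simp only [map_add, add_mul, hM, hN, mul_add, Finset.sum_add_distrib]

/-- The deformed determinant rule: exchanging the indices of two letters costs a scalar multiple of
`(ij)`. The entry `h` is the failure of `x_i` and `x_j` to commute. -/
theorem vars_mul_vars_sub (i j : I) (a b : Fin 2) :
    vars h i a * vars h j b - vars h j a * vars h i b =
      (!![h, 1; -1, 0] a b : ℂ) • bracket h i j := by
  have G := good_XY h (I := I)
  fin_cases a <;> fin_cases b <;> simp only [vars, bracket, Fin.zero_eta, Fin.mk_one,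
    Matrix.cons_val_zero, Matrix.cons_val_one, Matrix.of_apply, G.xx i j, G.xy i j, G.xy j i,
    G.yy i j] <;> module

/-- `w` is a polynomial in two variables that satisfies a form of Euler's identity of degree `m`, in
which polarization is exchanged with multiplication up to a multiple of the bracket. -/
def EulerIdentity (h : ℂ) (m : ℕ) (w : FreeAlgebra ℂ (Fin 2)) : Prop :=
  ∃ G : Fin 2 → FreeAlgebra ℂ (Fin 2), ∀ (I : Type u) [LinearOrder I] (i j : I) (a : Fin 2),
    (m : ℂ) • (vars h i a * evalVars h j w) - vars h j a * polD h j i (evalVars h j w) =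
      bracket h i j * evalVars h j (G a)

theorem polD_vars (i j : I) (b : Fin 2) : polD h j i (vars h j b) = vars h i b := by
  fin_cases b <;> simp [vars, polD_X, polD_Y]

theorem eulerIdentity_one (h : ℂ) : EulerIdentity.{u} h 0 1 := by
  refine ⟨0, fun I _ i j a => ?_⟩
  have := polD_algebraMap (h := h) j i 1
  rw [map_one] at this
  simp [this]

/-- By Leibniz, the defect for `w v^b` is the defect for `w` times `v_j^b` plus `v_i^a w v_j^b -
v_j^a w v_i^b`. In the latter, `w` is moved to the right, where `vars_mul_vars_sub` applies. -/
theorem EulerIdentity.mul_ι {h : ℂ} {m : ℕ} {w : FreeAlgebra ℂ (Fin 2)}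
    (hw : EulerIdentity.{u} h m w) (b : Fin 2) :
    EulerIdentity.{u} h (m + 1) (w * FreeAlgebra.ι ℂ b) := by
  obtain ⟨G, hG⟩ := hw
  obtain ⟨N, hN⟩ := exists_evalVars_mul_vars.{u} h w
  refine ⟨fun a => G a * FreeAlgebra.ι ℂ b + ∑ c, (!![h, 1; -1, 0] a c : ℂ) • N b c,
    fun I _ i j a => ?_⟩
  have e : vars h i a * (evalVars h j w * vars h j b) - vars h j a * (evalVars h j w * vars h i b) =
      bracket h i j * ∑ c, (!![h, 1; -1, 0] a c : ℂ) • evalVars h j (N b c) := by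
    -- The same coefficients `N` serve for `w(v_j) v_j^b` and `w(v_j) v_i^b`, since the exchange
    -- rule also holds for equal indices.
    rw [hN, hN, Finset.mul_sum, Finset.mul_sum, ← Finset.sum_sub_distrib, Finset.mul_sum]
    refine Finset.sum_congr rfl fun c _ => ?_
    rw [← mul_assoc, ← mul_assoc, ← sub_mul, vars_mul_vars_sub, smul_mul_assoc, mul_smul_comm]
  rw [map_add, map_sum, mul_add, map_mul (evalVars h j), map_mul (evalVars h j),
    ← mul_assoc (bracket h i j), evalVars_ι, ← hG]
  simp only [map_smul]
  rw [← e, polD_mul, polD_vars, sub_mul, mul_add, smul_mul_assoc, Nat.cast_succ, add_smul, one_smul]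
  simp only [mul_assoc]
  abel

theorem eulerIdentity_monomial (h : ℂ) (a b : ℕ) : EulerIdentity.{u} h (a + b)
    (FreeAlgebra.ι ℂ 0 ^ a * FreeAlgebra.ι ℂ 1 ^ b) := by
  induction b with
  | zero =>
    rw [pow_zero, mul_one, add_zero]
    induction a with
    | zero => rw [pow_zero]; exact eulerIdentity_one h
    | succ a ih => rw [pow_succ]; exact ih.mul_ι 0
  | succ b ih => rw [pow_succ, ← mul_assoc, ← add_assoc]; exact ih.mul_ι 1

theorem polD_of_mem_without {k l : I} {S : Set I} (hk : k ∈ S) {a : HAlg h I}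
    (ha : a ∈ without h S) : polD h k l a = 0 := by
  induction ha using without_induct with
  | hc c => exact polD_algebraMap k l c
  | hx i hi => rw [polD_X, if_neg (ne_of_mem_of_not_mem hk hi).symm]
  | hy i hi => rw [polD_Y, if_neg (ne_of_mem_of_not_mem hk hi).symm]
  | hadd a b _ _ ha hb => rw [map_add, ha, hb, add_zero]
  | hmul a b _ _ ha hb => rw [polD_mul, ha, hb, zero_mul, mul_zero, add_zero]

/-! ### Polarizations of a form -/

section Polarization
variable {n : ℕ} (A : Fin (n + 1) → HAlg h I)

/-- The value at the variables with index `i` of the form with coefficients `A`. -/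
noncomputable def formAt (A : Fin (n + 1) → HAlg h I) (i : I) : HAlg h I :=
  ∑ k : Fin (n + 1), X h i ^ (n - (k : ℕ)) * Y h i ^ (k : ℕ) * A k

/-- The coefficient of `s ^ (n - m) t ^ m` in the value of the form with coefficients `A` at
`s v_i + t v_j`. -/
noncomputable def polCoeff (A : Fin (n + 1) → HAlg h I) (i j : I) (m : ℕ) : HAlg h I :=
  ∑ k : Fin (n + 1), expandCoeff (pairList n k (X h i) (X h j) (Y h i) (Y h j)) m * A k

-- A single expansion of `f(s v_i + t v_j)` describes both polarizations: `s = 1`, `t = T` gives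
-- `e^{TΔ_{ij}}` on `f(v_i)`, and `s = T`, `t = 1` gives `e^{TΔ_{ji}}` on `f(v_j)`.
open Polynomial in
theorem sum_eq_sum_polCoeff (i j : I) {s t : (HAlg h I)[X]} (hs : ∀ a, Commute s a)
    (ht : ∀ a, Commute t a) :
    ∑ k : Fin (n + 1), (s * C (X h i) + t * C (X h j)) ^ (n - (k : ℕ)) *
        (s * C (Y h i) + t * C (Y h j)) ^ (k : ℕ) * C (A k) =
      ∑ p ∈ Finset.HasAntidiagonal.antidiagonal n, s ^ p.1 * t ^ p.2 * C (polCoeff A i j p.2) := by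
  simp only [pow_mul_pow_eq_sum hs ht (Nat.lt_succ_iff.1 (Fin.is_lt _)), Finset.sum_mul, polCoeff,
    map_sum, Finset.mul_sum, map_mul, map_expandCoeff_pairList]
  rw [Finset.sum_comm]
  simp only [mul_assoc]

variable {A} {i j : I}

open Polynomial in
theorem coeff_polT_formAt (hA : ∀ k, A k ∈ without h {i, j})
    {m : ℕ} (hm : m ≤ n) :
    (polT h i j (formAt A i)).coeff m = polCoeff A i j m := by
  have e := sum_eq_sum_polCoeff A i j (s := 1) (t := Polynomial.X) Commute.one_left
    fun a => (commute_X a)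
  have e' : polT h i j (formAt A i) = ∑ p ∈ Finset.HasAntidiagonal.antidiagonal n,
      (1 : (HAlg h I)[X]) ^ p.1 * Polynomial.X ^ p.2 * C (polCoeff A i j p.2) := by
    rw [← e, formAt, map_sum]
    refine Finset.sum_congr rfl fun k _ => ?_
    rw [map_mul, polT_of_mem_without (by simp) (hA k)]
    simp [polT, ← C_mul_X_eq_monomial, X_mul_C]
  rw [e', finsetSum_coeff, Finset.sum_eq_single (n - m, m)]
  · simp [X_pow_mul_C]
  · rintro ⟨a, b⟩ hp hab
    have hp := Finset.HasAntidiagonal.mem_antidiagonal.1 hp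
    have : m ≠ b := by
      rintro rfl
      exact hab (Prod.ext (by simp only at hp ⊢; omega) rfl)
    simp [X_pow_mul_C, this]
  · intro h0
    exact absurd (Finset.HasAntidiagonal.mem_antidiagonal.2 (by simp; omega)) h0

open Polynomial in
theorem coeff_polT_formAt' (hA : ∀ k, A k ∈ without h {i, j})
    {m : ℕ} (hm : m ≤ n) :
    (polT h j i (formAt A j)).coeff m = polCoeff A i j (n - m) := by
  have e := sum_eq_sum_polCoeff A i j (s := Polynomial.X) (t := 1) (fun a => (commute_X a))
    Commute.one_left
  have e' : polT h j i (formAt A j) = ∑ p ∈ Finset.HasAntidiagonal.antidiagonal n,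
      Polynomial.X ^ p.1 * (1 : (HAlg h I)[X]) ^ p.2 * C (polCoeff A i j p.2) := by
    rw [← e, formAt, map_sum]
    refine Finset.sum_congr rfl fun k _ => ?_
    rw [map_mul, polT_of_mem_without (by simp) (hA k)]
    simp [polT, ← C_mul_X_eq_monomial, X_mul_C, add_comm]
  rw [e', finsetSum_coeff, Finset.sum_eq_single (m, n - m)]
  · simp [X_pow_mul_C]
  · rintro ⟨a, b⟩ hp hab
    have hp := Finset.HasAntidiagonal.mem_antidiagonal.1 hp
    have : m ≠ a := by
      rintro rfl
      exact hab (Prod.ext rfl (by simp only at hp ⊢; omega))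
    simp [X_pow_mul_C, this]
  · intro h0
    exact absurd (Finset.HasAntidiagonal.mem_antidiagonal.2 (by simp; omega)) h0

/-- Set `s = 0` and `t = 1` in the expansion of `f(s v_i + t v_j)`. -/
theorem polCoeff_top (A : Fin (n + 1) → HAlg h I) (i j : I) : polCoeff A i j n = formAt A j := by
  refine Finset.sum_congr rfl fun k _ => ?_
  have e := pow_mul_pow_eq_sum (s := (0 : HAlg h I)) (t := 1) Commute.zero_left Commute.one_left
    (Nat.lt_succ_iff.1 k.2) (X h i) (X h j) (Y h i) (Y h j)
  rw [Finset.sum_eq_single (0, n)] at e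
  · simpa using congrArg (· * A k) e.symm
  · rintro ⟨a, b⟩ hp hab
    have hp := Finset.HasAntidiagonal.mem_antidiagonal.1 hp
    have : a ≠ 0 := by
      rintro rfl
      exact hab (Prod.ext rfl (by simpa using hp))
    simp [this]
  · intro h0
    exact absurd (Finset.HasAntidiagonal.mem_antidiagonal.2 (by simp)) h0

theorem isHomog_formAt {S : Set I} (hA : ∀ k, A k ∈ without h S) {i : I} (hi : i ∈ S) :
    IsHomog i n (formAt A i) := by
  refine IsHomog.sum fun k _ => ?_
  have := (((IsHomog.X_self (h := h) i).pow (n - k)).mul ((IsHomog.Y_self i).pow k)).mul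
    (isHomog_of_mem_without hi (hA k))
  rwa [mul_one, mul_one, add_zero, Nat.sub_add_cancel (Nat.lt_succ_iff.1 k.2)] at this

theorem polP_iterate_formAt (hA : ∀ k, A k ∈ without h {i, j})
    (hij : i ≠ j) {m : ℕ} (hm : m ≤ n) : (polP h i j)^[m] (formAt A i) =
    (((n - m).factorial * m.factorial : ℂ) / n.factorial) • polCoeff A i j m := by
  rw [(polP_iterate hij.symm (isHomog_formAt hA (by simp)) hm).2, polD_iterate_eq hij.symm,
    coeff_polT_formAt hA hm, smul_smul, div_mul_eq_mul_div]

theorem polP_iterate_formAt_self (hA : ∀ k, A k ∈ without h {i, j})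
    (hij : i ≠ j) : (polP h i j)^[n] (formAt A i) = formAt A j := by
  have : (n.factorial : ℂ) ≠ 0 := by exact_mod_cast n.factorial_ne_zero
  rw [polP_iterate_formAt hA hij le_rfl, polCoeff_top]
  simp [this]

theorem polP_formAt (hA : ∀ k, A k ∈ without h {i, j})
    : polP h j i (formAt A j) =
    (n : ℂ)⁻¹ • polD h j i (formAt A j) :=
  polP_of_homog _ _ _ _ (isHomog_formAt hA (by simp))

/-- Both sides are `1/n` times the coefficient of `s t^{n-1}` in `f(s v_i + t v_j)`: on the right
the factorials combine to `1! (n-1)! / n!`. -/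
theorem polP_formAt_eq_iterate (hA : ∀ k, A k ∈ without h {i, j})
    (hij : i ≠ j) (hn : 1 ≤ n) :
    polP h j i (formAt A j) = (polP h i j)^[n - 1] (formAt A i) := by
  have e := polD_iterate_eq hij 1 (formAt A j)
  rw [coeff_polT_formAt' hA hn] at e
  rw [polP_formAt hA, polP_iterate_formAt hA hij (by omega)]
  simp only [Function.iterate_one, Nat.factorial_one, Nat.cast_one, one_smul] at e
  obtain ⟨r, rfl⟩ : ∃ r, n = r + 1 := ⟨n - 1, by omega⟩
  have : (r.factorial : ℂ) ≠ 0 := by exact_mod_cast r.factorial_ne_zero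
  rw [e, show r + 1 - (r + 1 - 1) = 1 by omega, Nat.add_sub_cancel]
  congr 1
  have : (r + 1 : ℂ) ≠ 0 := by exact_mod_cast r.succ_ne_zero
  rw [Nat.factorial_succ r, Nat.factorial_one]
  push_cast
  field_simp

theorem reindex_formAt (hA : ∀ k, A k ∈ without h {i, j})
    (σ : I → I) (hσ : ∀ k, k ≠ i → k ≠ j → σ k = k) (l : I) :
    reindex h σ (formAt A l) = formAt A (σ l) := by
  simp only [formAt, map_sum, map_mul, map_pow, reindex_X, reindex_Y]
  refine Finset.sum_congr rfl fun k _ => ?_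
  rw [reindex_of_mem_without (fun m hm => ?_) (hA k)]
  simp only [Set.mem_insert_iff, Set.mem_singleton_iff, not_or] at hm
  exact hσ m hm.1 hm.2

/-- Swapping `i` and `j` is an injective endomorphism that fixes the coefficients. -/
theorem formAt_ne_zero (hA : ∀ k, A k ∈ without h {i, j})
    (h0 : formAt A i ≠ 0) : formAt A j ≠ 0 := by
  have := reindex_formAt hA (Equiv.swap i j) (fun k => Equiv.swap_apply_of_ne_of_ne) i
  rw [Equiv.swap_apply_left] at this
  rw [← this]
  exact (map_ne_zero_iff _ (reindex_injective _)).2 h0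

theorem formAt_mem_without (hA : ∀ k, A k ∈ without h {i, j})
    (hij : i ≠ j) : formAt A j ∈ without h {i} := by
  refine sum_mem fun k _ => mul_mem (mul_mem (pow_mem (X_mem_without ?_) _)
    (pow_mem (Y_mem_without ?_) _)) (without_mono ?_ (hA k)) <;> simp [hij.symm]

end Polarization

/-! ### Independence of the monomials in `ξ` and `η`. -/

/-- Forms in `ξ`, `η` are determined by their coefficients, if these are fixed by a specialization
that kills `η` but not `ξ`. -/
theorem eq_zero_of_sum_pow_mul_pow {R : Type*} [Ring R] [NoZeroDivisors R] {ξ η : R}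
    (π : R →+* R) (hη : η ≠ 0) (hc : Commute η ξ) (hπη : π η = 0) (hπξ : π ξ ≠ 0) {N : ℕ}
    (c : Fin N → R) (hπ : ∀ k, π (c k) = c k)
    (h0 : ∑ k : Fin N, ξ ^ (N - 1 - (k : ℕ)) * η ^ (k : ℕ) * c k = 0) (k : Fin N) : c k = 0 := by
  induction N with
  | zero => exact k.elim0
  | succ N ih =>
    rw [Fin.sum_univ_succ] at h0
    -- Under `π` only the pure power of `ξ` survives. Once its coefficient is gone, `η` divides the
    -- rest and can be cancelled.
    have hc0 : c 0 = 0 := by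
      have := congrArg π h0
      simp only [map_add, map_mul, map_pow, map_sum, hπ, hπη, map_zero, Fin.val_succ] at this
      simpa [pow_succ, pow_ne_zero N hπξ] using this
    have h1 : η * ∑ k : Fin N, ξ ^ (N - 1 - (k : ℕ)) * η ^ (k : ℕ) * c k.succ = 0 := by
      rw [hc0, mul_zero, zero_add] at h0
      rw [← h0, Finset.mul_sum]
      refine Finset.sum_congr rfl fun k _ => ?_
      rw [← mul_assoc, ← mul_assoc, (hc.pow_right _).eq, Fin.val_succ, pow_succ' η, ← mul_assoc,
        show N + 1 - 1 - ((k : ℕ) + 1) = N - 1 - k by omega]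
    refine Fin.cases hc0 (fun k => ?_) k
    exact ih (fun k => c k.succ) (fun k => hπ _) ((mul_eq_zero.1 h1).resolve_left hη) k

/-! ### Universal coefficients of a typical representation. -/

/-- The inclusion of the polynomials in `x_i, y_i` in those that also involve the coefficients. -/
noncomputable def inclVars (n : ℕ) :
    FreeAlgebra ℂ (Fin 2) →ₐ[ℂ] FreeAlgebra ℂ (Fin (n + 1) ⊕ Fin 2) :=
  FreeAlgebra.lift ℂ fun b => FreeAlgebra.ι ℂ (Sum.inr b)

theorem polyEval_inclVars {n : ℕ} (A : Fin (n + 1) → HAlg h I) (i : I)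
    (w : FreeAlgebra ℂ (Fin 2)) : polyEval (inclVars n w) A i = evalVars h i w := by
  have : (FreeAlgebra.lift ℂ (Sum.elim A ![X h i, Y h i])).comp (inclVars n) = evalVars h i := by
    apply FreeAlgebra.hom_ext
    funext b
    simp [inclVars, evalVars, vars]
  exact DFunLike.congr_fun this w

theorem polyEval_mem {n : ℕ} {A : Fin (n + 1) → HAlg h I} {i : I} {S : Subalgebra ℂ (HAlg h I)}
    (hA : ∀ k, A k ∈ S) (hx : X h i ∈ S) (hy : Y h i ∈ S)
    (w : FreeAlgebra ℂ (Fin (n + 1) ⊕ Fin 2)) : polyEval w A i ∈ S := by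
  rw [polyEval]
  induction w using FreeAlgebra.induction with
  | grade0 r => rw [AlgHom.commutes]; exact S.algebraMap_mem r
  | grade1 b =>
    rw [FreeAlgebra.lift_ι_apply]
    rcases b with k | b
    · exact hA k
    · fin_cases b
      exacts [hx, hy]
  | mul v w hv hw => rw [map_mul]; exact mul_mem hv hw
  | add v w hv hw => rw [map_add]; exact add_mem hv hw

/-- The coefficients of `ξ`, `η` in the linear factors of a typical representation. -/
theorem exists_linear_factors (h : ℂ) (n : ℕ) (hn : 1 ≤ n) :
    ∃ g : Fin 2 → FreeAlgebra ℂ (Fin (n + 1) ⊕ Fin 2), ∀ (I : Type u) [LinearOrder I] (i j : I)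
      (A : Fin (n + 1) → HAlg h I) (a : Fin 2), (∀ k, A k ∈ without h {i, j}) →
      vars h i a * formAt A j = vars h j a * polP h j i (formAt A j) +
        bracket h i j * polyEval (g a) A j := by
  have key : ∀ k : Fin (n + 1), EulerIdentity.{u} h n
      (FreeAlgebra.ι ℂ 0 ^ (n - (k : ℕ)) * FreeAlgebra.ι ℂ 1 ^ (k : ℕ)) := fun k => by
    have := eulerIdentity_monomial.{u} h (n - k) k
    rwa [Nat.sub_add_cancel (Nat.lt_succ_iff.1 k.2)] at this
  choose G hG using key
  -- Sum the universal Euler remainders of the monomials of `f_1`, each times its coefficient `A_k`,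
  -- which `Δ_{ji}` kills; the factor `1/n` turns `Δ_{ji}` into `P_{ji}`.
  refine ⟨fun a => (n : ℂ)⁻¹ • ∑ k, inclVars n (G k a) * FreeAlgebra.ι ℂ (Sum.inl k),
    fun I _ i j A a hA => ?_⟩
  have hn' : (n : ℂ) ≠ 0 := by exact_mod_cast (by omega : n ≠ 0)
  have e1 : ∀ w, polyEval ((n : ℂ)⁻¹ • w) A j = (n : ℂ)⁻¹ • polyEval w A j :=
    fun w => map_smul _ _ _
  have e2 : polyEval (∑ k, inclVars n (G k a) * FreeAlgebra.ι ℂ (Sum.inl k)) A j =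
      ∑ k, evalVars h j (G k a) * A k := by
    rw [polyEval, map_sum]
    refine Finset.sum_congr rfl fun k _ => ?_
    rw [map_mul, FreeAlgebra.lift_ι_apply, ← polyEval_inclVars A]
    rfl
  have e3 : formAt A j = ∑ k : Fin (n + 1), evalVars h j
      (FreeAlgebra.ι ℂ 0 ^ (n - (k : ℕ)) * FreeAlgebra.ι ℂ 1 ^ (k : ℕ)) * A k := by
    simp [formAt, evalVars, vars]
  have e4 : (n : ℂ) • (vars h i a * formAt A j) - vars h j a * polD h j i (formAt A j) =
      bracket h i j * ∑ k, evalVars h j (G k a) * A k := by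
    rw [e3, map_sum, Finset.mul_sum, Finset.mul_sum, Finset.mul_sum, Finset.smul_sum,
      ← Finset.sum_sub_distrib]
    refine Finset.sum_congr rfl fun k _ => ?_
    rw [polD_mul, polD_of_mem_without (by simp) (hA k), mul_zero, add_zero, ← mul_assoc,
      ← mul_assoc, ← mul_assoc, ← hG, sub_mul, smul_mul_assoc]
  rw [e1, e2, polP_formAt hA, mul_smul_comm, mul_smul_comm, ← smul_add, ← e4, add_sub_cancel,
    inv_smul_smul₀ hn']

/-- The coefficients of `ξ ^ (n - m) * η ^ m` in a typical representation. -/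
noncomputable def typicalCoeff {n : ℕ} (g : Fin 2 → FreeAlgebra ℂ (Fin (n + 1) ⊕ Fin 2)) (m : ℕ) :
    FreeAlgebra ℂ (Fin (n + 1) ⊕ Fin 2) :=
  ∑ k : Fin (n + 1), expandCoeff (pairList n k (FreeAlgebra.ι ℂ (Sum.inr 0)) (g 0)
    (FreeAlgebra.ι ℂ (Sum.inr 1)) (g 1)) m * FreeAlgebra.ι ℂ (Sum.inl k)

theorem polyEval_typicalCoeff {n : ℕ} (g : Fin 2 → FreeAlgebra ℂ (Fin (n + 1) ⊕ Fin 2))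
    (A : Fin (n + 1) → HAlg h I) (i : I) (m : ℕ) : polyEval (typicalCoeff g m) A i =
      ∑ k : Fin (n + 1), expandCoeff (pairList n k (X h i) (polyEval (g 0) A i) (Y h i)
        (polyEval (g 1) A i)) m * A k := by
  rw [polyEval, typicalCoeff, map_sum]
  refine Finset.sum_congr rfl fun k _ => ?_
  have e := map_expandCoeff_pairList
    (FreeAlgebra.lift ℂ (Sum.elim A ![X h i, Y h i]) : _ →+* HAlg h I) n k
    (FreeAlgebra.ι ℂ (Sum.inr 0)) (g 0) (FreeAlgebra.ι ℂ (Sum.inr 1)) (g 1) m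
  simp only [RingHom.coe_coe, FreeAlgebra.lift_ι_apply, Sum.elim_inr, Matrix.cons_val_zero,
    Matrix.cons_val_one] at e
  rw [map_mul, e, FreeAlgebra.lift_ι_apply]
  rfl

theorem pow_mul_pow_mul_pow {R : Type*} [Ring R] {F : R} (hF : ∀ a, Commute F a) (x y a : R)
    {n k : ℕ} (hk : k ≤ n) :
    F ^ n * (x ^ (n - k) * y ^ k * a) = (x * F) ^ (n - k) * (y * F) ^ k * a := by
  obtain ⟨m, rfl⟩ := Nat.exists_eq_add_of_le hk
  rw [(hF x).symm.mul_pow, (hF y).symm.mul_pow, Nat.add_sub_cancel_left, add_comm k m, pow_add,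
    mul_assoc (F ^ m), ← mul_assoc (F ^ k), ← mul_assoc (F ^ k), ((hF (x ^ m)).pow_left k).eq,
    mul_assoc (x ^ m), ((hF (y ^ k)).pow_left k).eq, ← mul_assoc (F ^ m), ← mul_assoc (F ^ m),
    ((hF (x ^ m)).pow_left m).eq]

/-- The central `f_1^n` is distributed over the `n` letters of each monomial of `f`; every `x_i
f_1`, `y_i f_1` is then replaced by its linear expression in the central `ξ`, `η`. -/
theorem formAt_pow_mul_formAt {n : ℕ} {g : Fin 2 → FreeAlgebra ℂ (Fin (n + 1) ⊕ Fin 2)}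
    {A : Fin (n + 1) → HAlg h I} {i j : I} {ξ η : HAlg h I} (hξ : ∀ a, Commute ξ a)
    (hη : ∀ a, Commute η a) (hf : ∀ a, Commute (formAt A j) a)
    (hg : ∀ a, vars h i a * formAt A j = vars h j a * ξ + η * polyEval (g a) A j) :
    formAt A j ^ n * formAt A i =
      ∑ k : Fin (n + 1), ξ ^ (n - (k : ℕ)) * η ^ (k : ℕ) * polyEval (typicalCoeff g k) A j := by
  have hx := hg 0
  have hy := hg 1
  simp only [vars, Matrix.cons_val_zero, Matrix.cons_val_one, ← (hξ _).eq] at hx hy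
  have e : ∀ k : Fin (n + 1), formAt A j ^ n * (X h i ^ (n - (k : ℕ)) * Y h i ^ (k : ℕ) * A k) =
      (ξ * X h j + η * polyEval (g 0) A j) ^ (n - (k : ℕ)) *
        (ξ * Y h j + η * polyEval (g 1) A j) ^ (k : ℕ) * A k := fun k => by
    rw [← hx, ← hy, pow_mul_pow_mul_pow hf _ _ _ (Nat.lt_succ_iff.1 k.2)]
  conv_lhs => rw [formAt.eq_1 A i, Finset.mul_sum]
  simp only [e, pow_mul_pow_eq_sum hξ hη (Nat.lt_succ_iff.1 (Fin.is_lt _)), Finset.sum_mul]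
  -- The swap makes the exponent of `η`, not that of `ξ`, the summation index.
  rw [Finset.sum_comm, ← Finset.Nat.sum_antidiagonal_swap,
    Finset.Nat.sum_antidiagonal_eq_sum_range_succ_mk, Finset.sum_range]
  refine Finset.sum_congr rfl fun k _ => ?_
  rw [polyEval_typicalCoeff, Finset.mul_sum]
  simp only [Prod.swap, mul_assoc]

end NCForm

/-! ### The typical representation. -/

theorem theorem13 (h : ℂ) (n : ℕ) (hn : 1 ≤ n) :
    ∃ (C : Fin (n + 1) → FreeAlgebra ℂ (Fin (n + 1) ⊕ Fin 2)) (m : Fin (n + 1) → ℕ),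
      ∀ (I : Type u) [LinearOrder I] (i₀ i₁ : I), i₀ ≠ i₁ →
      ∀ (f : NCForm.HAlg h I) (A : Fin (n + 1) → NCForm.HAlg h I),
        NCForm.IsForm i₀ n f →
        (∀ k, A k ∈ NCForm.without h {i₀, i₁}) →
        f = ∑ k : Fin (n + 1),
          NCForm.X h i₀ ^ (n - (k : ℕ)) * NCForm.Y h i₀ ^ (k : ℕ) * A k →
        let f₁ := (NCForm.polP h i₀ i₁)^[n] f
        let ξ := (NCForm.polP h i₀ i₁)^[n - 1] f
        let η := NCForm.bracket h i₀ i₁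
        let v : Fin (n + 1) → NCForm.HAlg h I := fun k => NCForm.polyEval (C k) A i₁
        f₁ ≠ 0 ∧ f₁ ∈ NCForm.without h {i₀} ∧
        NCForm.polP h i₁ i₀ f₁ = ξ ∧
        NCForm.IsForm i₀ 1 ξ ∧ NCForm.IsForm i₀ 1 η ∧
        ξ ∈ Subalgebra.center ℂ (NCForm.HAlg h I) ∧
        η ∈ Subalgebra.center ℂ (NCForm.HAlg h I) ∧
        (∀ k, v k ∈ NCForm.without h {i₀}) ∧
        (∀ k, v k = 0 ∨ NCForm.IsForm i₁ (m k) (v k)) ∧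
        NCForm.toQ h I f = ((NCForm.toQ h I f₁)⁻¹) ^ n *
          ∑ k : Fin (n + 1), NCForm.toQ h I ξ ^ (n - (k : ℕ)) * NCForm.toQ h I η ^ (k : ℕ) *
            NCForm.toQ h I (v k) := by
  open NCForm in
  obtain ⟨g, hg⟩ := exists_linear_factors.{u} h n hn
  -- In the index 1, `f_1`, `f`, `ξ`, `η` have degrees `n`, `0`, `n - 1`, `1`; comparing degrees in
  -- `f_1^n f = ∑ ξ^{n-k} η^k u_k` dictates the degree of `u_k`.
  refine ⟨fun k => typicalCoeff g k, fun k => n ^ 2 - ((n - k) * (n - 1) + k), ?_⟩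
  intro I _ i j hij f A hform hA hf f₁ ξ η v
  have hf : f = formAt A i := hf
  have hf₁ : f₁ = formAt A j := by
    simp only [f₁]; rw [hf, polP_iterate_formAt_self hA hij]
  have hξ : ξ = polP h j i f₁ := by
    rw [hf₁, polP_formAt_eq_iterate hA hij hn, ← hf]
  have hdeg : IsHomog i n f := hf ▸ isHomog_formAt hA (by simp)
  have hf₁deg : IsHomog j n f₁ := hf₁ ▸ isHomog_formAt hA (by simp)
  have hinv : ∀ m, IsInvariant ((polD h i j)^[m] f) := fun m => by
    induction m with
    | zero => exact hform.2.1
    | succ m ih => rw [Function.iterate_succ_apply']; exact ih.polD i j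
  have hf₁inv : IsInvariant f₁ := by
    simp only [f₁]
    rw [(polP_iterate hij.symm hdeg le_rfl).2]
    exact (hinv n).smul _
  have hξinv : IsInvariant ξ := by
    simp only [ξ]
    rw [(polP_iterate hij.symm hdeg (Nat.sub_le n 1)).2]
    exact (hinv (n - 1)).smul _
  have hηinv : IsInvariant η := isInvariant_bracket i j
  have hcomm : ∀ {a : HAlg h I}, IsInvariant a → ∀ b, Commute a b := fun ha b =>
    ((Subalgebra.mem_center_iff.1 ha.mem_center) b).symm
  have hf₁0 : f₁ ≠ 0 := by
    rw [hf₁]; exact formAt_ne_zero hA (hf ▸ hform.1)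
  have hf₁mem : f₁ ∈ without h {i} := hf₁ ▸ formAt_mem_without hA hij
  have hη0 : η ≠ 0 := bracket_ne_zero hij
  have hgl : ∀ a, vars h i a * f₁ = vars h j a * ξ + η * polyEval (g a) A j := fun a => by
    rw [hξ, hf₁]; exact hg I i j A a hA
  -- Collapsing the index 0 onto 1 turns `η` into `(11) = 0` and fixes whatever does not involve the
  -- index 0.
  let π := reindex h (Function.update id i j)
  have hπ : ∀ {a}, a ∈ without h {i} → π a = a := fun ha =>
    reindex_of_mem_without (fun k hk => Function.update_of_ne (by simpa using hk) _ _) ha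
  have hπη : π η = 0 := by
    simp only [π, η]
    rw [reindex_bracket]
    simp [hij.symm, bracket_self]
  -- The image of `x_0 f_1 = x_1 ξ + η g_0` is `x_1 f_1 = x_1 π(ξ)`, and `x_1` can be cancelled.
  have hπξ : π ξ = f₁ := by
    have := congrArg π (hgl 0)
    rw [map_mul, map_add, map_mul, map_mul, hπη, zero_mul, add_zero, hπ hf₁mem] at this
    simp only [vars, Matrix.cons_val_zero, π, reindex_X, Function.update_self,
      Function.update_of_ne hij.symm, id] at this
    exact (mul_left_cancel₀ (X_ne_zero j) this).symm
  have hξ0 : ξ ≠ 0 := by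
    intro h0
    rw [h0, map_zero] at hπξ
    exact hf₁0 hπξ.symm
  have hvmem : ∀ k, v k ∈ without h {i} := fun k =>
    polyEval_mem (fun k => without_mono (by simp) (hA k)) (X_mem_without (by simpa using hij.symm))
      (Y_mem_without (by simpa using hij.symm)) _
  have hmain : f₁ ^ n * f = ∑ k : Fin (n + 1), ξ ^ (n - (k : ℕ)) * η ^ (k : ℕ) * v k := by
    rw [hf, hf₁]
    rw [hf₁] at hgl hf₁inv
    exact formAt_pow_mul_formAt (hcomm hξinv) (hcomm hηinv) (hcomm hf₁inv) hgl
  have hind : ∀ c : Fin (n + 1) → HAlg h I, (∀ k, c k ∈ without h {i}) →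
      ∑ k : Fin (n + 1), ξ ^ (n - (k : ℕ)) * η ^ (k : ℕ) * c k = 0 → ∀ k, c k = 0 :=
    fun c hc h0 => eq_zero_of_sum_pow_mul_pow (π : HAlg h I →+* HAlg h I) hη0 (hcomm hηinv _) hπη
      (by change π ξ ≠ 0; rwa [hπξ]) c (fun k => hπ (hc k)) h0
  have hprod : ∀ k : Fin (n + 1), IsInvariant (ξ ^ (n - (k : ℕ)) * η ^ (k : ℕ)) := fun k =>
    (hξinv.pow _).mul (hηinv.pow _)
  have hlhs : IsInvariant (f₁ ^ n * f) := (hf₁inv.pow n).mul hform.2.1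
  -- Each operator annihilates `f_1^n f` and passes through the invariants `ξ^{n-k} η^k`; the
  -- resulting coefficients still avoid the index 0, so they vanish by independence.
  have hvinv : ∀ k, IsInvariant (v k) := by
    refine fun k => ⟨?_, ?_, ?_⟩
    · refine hind (fun k => opE h I (v k)) (fun k => opE_mem_without (hvmem k)) ?_ k
      have := hlhs.1
      rw [hmain, map_sum] at this
      simpa only [fun k => (hprod k).opE_mul] using this
    · refine hind (fun k => opF h I (v k)) (fun k => opF_mem_without (hvmem k)) ?_ k
      have := hlhs.2.1
      rw [hmain, map_sum] at this
      simpa only [fun k => (hprod k).opF_mul] using this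
    · refine hind (fun k => opH h I (v k)) (fun k => opH_mem_without (hvmem k)) ?_ k
      have := hlhs.2.2
      rw [hmain, map_sum] at this
      simpa only [fun k => (hprod k).opH_mul] using this
  have hξdeg : IsHomog j (n - 1) ξ := by
    rw [hξ, polP_of_homog _ _ _ _ hf₁deg]
    obtain ⟨r, rfl⟩ : ∃ r, n = r + 1 := ⟨n - 1, by omega⟩
    exact (hf₁deg.polD hij).smul _
  have hξdeg' : IsHomog i 1 ξ := by
    have := (polP_iterate hij.symm hdeg (Nat.sub_le n 1))
    rw [show n - (n - 1) = 1 by omega] at this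
    simp only [ξ]
    rw [this.2]
    exact this.1.smul _
  have hηdeg : IsHomog j 1 η ∧ IsHomog i 1 η := by
    have hx := IsHomog.X_self (h := h) i
    have hy := IsHomog.Y_self (h := h) i
    have hx' := IsHomog.X_self (h := h) j
    have hy' := IsHomog.Y_self (h := h) j
    have hx0 := IsHomog.X_of_ne (h := h) hij
    have hy0 := IsHomog.Y_of_ne (h := h) hij
    have hx0' := IsHomog.X_of_ne (h := h) hij.symm
    have hy0' := IsHomog.Y_of_ne (h := h) hij.symm
    exact ⟨((hx0.mul hy').sub (hy0.mul hx')).sub ((hy0.mul hy').smul h),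
      ((hx.mul hy0').sub (hy.mul hx0')).sub ((hy.mul hy0').smul h)⟩
  have hvdeg : ∀ k : Fin (n + 1), IsHomog j (n ^ 2 - ((n - k) * (n - 1) + k)) (v k) := by
    have hle : ∀ k : Fin (n + 1), (n - k) * (n - 1) + k ≤ n ^ 2 := fun k => by
      have hk := Nat.lt_succ_iff.1 k.2
      calc (n - k) * (n - 1) + k ≤ (n - k) * n + k * n :=
            add_le_add (Nat.mul_le_mul_left _ (Nat.sub_le _ _)) (Nat.le_mul_of_pos_right _ hn)
        _ = n ^ 2 := by rw [← add_mul, Nat.sub_add_cancel hk, sq]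
    have hP : ∀ k : Fin (n + 1), degHom h j (ξ ^ (n - (k : ℕ)) * η ^ (k : ℕ)) =
        Polynomial.monomial ((n - k) * (n - 1) + k) (ξ ^ (n - (k : ℕ)) * η ^ (k : ℕ)) := fun k => by
      have := (hξdeg.pow (n - k)).mul (hηdeg.1.pow k)
      rwa [mul_one] at this
    have hL : IsHomog j (n ^ 2) (f₁ ^ n * f) := by
      have := (hf₁deg.pow n).mul (show IsHomog j 0 f from ?_)
      · rwa [add_zero, ← sq] at this
      · rw [hf]
        refine IsHomog.sum fun k _ => ?_
        have := (((IsHomog.X_of_ne (h := h) hij).pow (n - k)).mul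
          ((IsHomog.Y_of_ne hij).pow k)).mul (isHomog_of_mem_without (k := j) (by simp) (hA k))
        simpa using this
    -- The component of total degree `r` of the expansion is zero unless `r = n^2`. The `if` sets to
    -- 0 the coefficients for which `ξ^{n-k} η^k` alone already exceeds degree `r`.
    have hz : ∀ r, r ≠ n ^ 2 → ∀ k : Fin (n + 1), (if (n - k) * (n - 1) + k ≤ r then
        (degHom h j (v k)).coeff (r - ((n - k) * (n - 1) + k)) else 0) = 0 := fun r hr => by
      refine hind _ (fun k => ?_) ?_
      · split_ifs
        exacts [coeff_degHom_mem_without j (hvmem k) _, zero_mem _]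
      · have := congrArg (fun p => Polynomial.coeff (degHom h j p) r) hmain
        simp only [map_sum, map_mul (degHom h j) _ (v _), hP, Polynomial.finsetSum_coeff,
          ← Polynomial.C_mul_X_pow_eq_monomial, mul_assoc (Polynomial.C _),
          Polynomial.coeff_C_mul, Polynomial.coeff_X_pow_mul'] at this
        rw [← this, hL, Polynomial.coeff_monomial, if_neg hr.symm]
    intro k
    have hmono : degHom h j (v k) = Polynomial.monomial (n ^ 2 - ((n - k) * (n - 1) + k))
        ((degHom h j (v k)).coeff (n ^ 2 - ((n - k) * (n - 1) + k))) := by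
      ext r
      rw [Polynomial.coeff_monomial]
      split_ifs with hr
      · rw [hr]
      · have hk := hle k
        have := hz (r + ((n - k) * (n - 1) + k)) (by omega) k
        rwa [if_pos (Nat.le_add_left _ _), Nat.add_sub_cancel] at this
    -- The single surviving component is `v k` itself, as setting `T = 1` sums all components.
    have e := degHom_eval_one j (v k)
    rw [hmono, Polynomial.eval_monomial, one_pow, mul_one] at e
    rw [e] at hmono
    exact hmono
  refine ⟨hf₁0, hf₁mem, hξ.symm, hξdeg'.isForm hξ0 hξinv, hηdeg.2.isForm hη0 hηinv,
    hξinv.mem_center, hηinv.mem_center, hvmem, fun k => ?_, ?_⟩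
  · by_cases h0 : v k = 0
    · exact Or.inl h0
    · exact Or.inr ((hvdeg k).isForm h0 (hvinv k))
  · have h0 : toQ h I f₁ ≠ 0 := (map_ne_zero_iff _ toQ_injective).2 hf₁0
    have := congrArg (toQ h I) hmain
    simp only [map_mul, map_sum, map_pow] at this
    rw [← this, inv_pow, inv_mul_cancel_left₀ (pow_ne_zero n h0)]
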